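/- **Definitions.** A *weight* on $\mathbb Z$ is a map $\omega:\mathbb Z\to[1,\infty)$ with $\omega(m+n)\le\omega(m)\omega(n)$ for all $m,n\in\mathbb Z$. Put $$\rho_{1,\omega}=\sup_{n\ge 1}\omega(-n)^{-1/n},\qquad \rho_{2,\omega}=\inf_{n\ge 1}\omega(n)^{1/n};$$ $\omega$ is *admissible* if $\rho_{1,\omega}=1=\rho_{2,\omega}$. Let $1<p<\infty$ and $\frac1p+\frac1q=1$. A weight $\omega$ is an *almost monotone algebra weight* (with respect to $p$) if 1. $\sum_{n\in\mathbb Z}\omega(n)^{-q}<\infty$ and $\sum_{k\in\mathbb Z}\omega(k)^{-q}\omega(n-k)^{-q}\le\omega(n)^{-q}$ for all $n\in\mathbb Z$; 2. if $\rho_{1,\omega}=1$, there is $K>0$ with $\omega(n)\le K\omega(n+k)$ for all integers $n,k<0$; 3. if $\rho_{2,\omega}=1$, there is $K>0$ with $\omega(n)\le K\omega(n+k)$ for all integers $n,k\ge0$. Let $\mathcal A$ be a complex unital Banach algebra and $\mathbb T=\{z\in\mathbb C:|z|=1\}$. For a continuous function $f:\mathbb T\to\mathcal A$ let $\widehat f(n)=\frac1{2\pi}\int_0^{2\pi}f(e^{it})e^{-int}\,dt$.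 Then $f$ *has $p\omega$-ACFS* ($p$-th power $\omega$-absolutely convergent Fourier series) if $f(z)=\sum_{n\in\mathbb Z}\widehat f(n)z^n$ for all $z\in\mathbb T$ and $\sum_{n\in\mathbb Z}\|\widehat f(n)\|^p\omega(n)^p<\infty$. **Theorem.** Let $1<p<\infty$, let $q$ be its conjugate index, let $\omega$ be an almost monotone algebra weight on $\mathbb Z$, let $\mathcal A$ be a complex unital Banach algebra, and let $f\in C(\mathbb T,\mathcal A)$ have $p\omega$-ACFS. If $f(z)$ is left invertible (respectively right invertible, invertible) in $\mathcal A$ for every $z\in\mathbb T$, then there are an almost monotone algebra weight $\nu$ on $\mathbb Z$ (with respect to the same $p$) and $g\in C(\mathbb T,\mathcal A)$ such that 1. $1\le\nu\le K\omega$ for some constant $K>0$; 2. $g$ has $p\nu$-ACFS; 3. $g$ is a left inverse (respectively right inverse, two-sided inverse) of $f$ in $C(\mathbb T,\mathcal A)$. Moreover, if $\omega$ is admissible, then $f$ has a left inverse (respectively right inverse, two-sided inverse) $g\in C(\mathbb T,\mathcal A)$ that has $p\omega$-ACFS. -/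

import Mathlib

namespace WeightedACFS

/-- A weight on `ℤ`: a map `ω : ℤ → [1, ∞)` with `ω (m + n) ≤ ω m * ω n`. -/
structure IsWeight (ω : ℤ → ℝ) : Prop where
  one_le : ∀ n, 1 ≤ ω n
  submul : ∀ m n, ω (m + n) ≤ ω m * ω n

/-- `ρ₁ = sup {ω(-n)^(-1/n) : n = 1, 2, …}`. For a weight the set is bounded above by `1`. -/
noncomputable def rho1 (ω : ℤ → ℝ) : ℝ :=
  ⨆ n : ℕ+, ω (-((n : ℕ) : ℤ)) ^ (-(1 / ((n : ℕ) : ℝ)))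

/-- `ρ₂ = inf {ω(n)^(1/n) : n = 1, 2, …}`. For a weight the set is bounded below by `1`. -/
noncomputable def rho2 (ω : ℤ → ℝ) : ℝ :=
  ⨅ n : ℕ+, ω ((n : ℕ) : ℤ) ^ (1 / ((n : ℕ) : ℝ))

/-- A weight is admissible if `ρ₁ = 1 = ρ₂`. -/
structure IsAdmissible (ω : ℤ → ℝ) : Prop extends IsWeight ω where
  rho1_eq : rho1 ω = 1
  rho2_eq : rho2 ω = 1

/-- Almost monotone algebra weights, relative to the exponent `q`. The series in `conv_le` converges
because `ω^(-q)` is summable and bounded by `1`. -/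
structure IsAlmostMonotoneAlgebraWeight (q : ℝ) (ω : ℤ → ℝ) : Prop extends IsWeight ω where
  summable : Summable fun n : ℤ => ω n ^ (-q)
  conv_le : ∀ n : ℤ, ∑' k : ℤ, ω k ^ (-q) * ω (n - k) ^ (-q) ≤ ω n ^ (-q)
  left_monotone : rho1 ω = 1 →
    ∃ K : ℝ, 0 < K ∧ ∀ n k : ℤ, n < 0 → k < 0 → ω n ≤ K * ω (n + k)
  right_monotone : rho2 ω = 1 →
    ∃ K : ℝ, 0 < K ∧ ∀ n k : ℤ, 0 ≤ n → 0 ≤ k → ω n ≤ K * ω (n + k)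

/-- The Fourier coefficient `(1 / 2π) ∫₀^{2π} f(e^{it}) e^{-int} dt`. -/
noncomputable def fourierCoefficient {A : Type*} [NormedRing A] [NormedAlgebra ℂ A]
    (f : C(Circle, A)) (n : ℤ) : A :=
  ((1 / (2 * Real.pi) : ℝ) : ℂ) •
    ∫ t in (0 : ℝ)..(2 * Real.pi),
      Complex.exp (-((n : ℂ) * (t : ℂ) * Complex.I)) • f (Circle.exp t)

/-- `f` has `p`-th power `ω`-absolutely convergent Fourier series. -/
structure HasACFS {A : Type*} [NormedRing A] [NormedAlgebra ℂ A]
    (p : ℝ) (ω : ℤ → ℝ) (f : C(Circle, A)) : Prop where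
  hasSum : ∀ z : Circle, HasSum (fun n : ℤ => ((z : ℂ) ^ n) • fourierCoefficient f n) (f z)
  summable : Summable fun n : ℤ => ‖fourierCoefficient f n‖ ^ p * ω n ^ p

end WeightedACFS

namespace WeightedACFS

/-! This is a noncommutative form of Gelfand's proof of Wiener's lemma. Hölder's inequality and the
convolution condition on `ω` make the weighted `ℓ^p` norm of Fourier coefficients submultiplicative
(`convolution_rpow_le`, `HasACFS.mul_bound`), so the functions with ACFS form a Banach algebra
`ACFSAlgebra`, in which the variable `z` is a central unit.

Suppose that `f` has no left inverse there, and take a maximal left ideal `M` containing `f`.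
Multiplication by `z` acts on the simple module of cosets of `M`; a Schur argument and nonempty
spectrum give a scalar `μ` with `z - μ ∈ M` (`exists_maximal_left_ideal`). Then `z ^ n - μ ^ n ∈ M`
for all integers `n`, and since `M` stays away from `1`, `|μ| ^ n` is at most a constant times `ω
n`. For admissible `ω` this forces `|μ| = 1`. Since `M` is closed, expanding `f` in monomials puts
the constant `f(μ)` in `M`; its left invertibility in `A` contradicts `1 ∉ M`
(`exists_left_inverse`). Right inverses come from the opposite algebra.

For non-admissible `ω`, invertibility on the circle says nothing about the larger annulus allowed
for `μ`. The weight is therefore first lowered to an admissible one (`exists_admissible_weight_le`):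
a side of exponential growth is replaced by the mirror image of the other side, or both sides by a
quadratic weight. -/

/-! ### Maximal left ideals and a central element -/

/-- If `z` is central in a complex Banach algebra and `f` has no left inverse, then `f` and `z - μ`,
for some scalar `μ`, lie in a common closed proper left ideal. -/
theorem exists_maximal_left_ideal {R : Type*} [NormedRing R] [NormedAlgebra ℂ R] [CompleteSpace R]
    (z f : R) (hz : ∀ x, z * x = x * z) (hf : ∀ g, g * f ≠ 1) :
    ∃ (M : Ideal R) (μ : ℂ), IsClosed (M : Set R) ∧ (1 : R) ∉ M ∧ f ∈ M ∧
      z - algebraMap ℂ R μ ∈ M := by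
  have hne : Ideal.span {f} ≠ ⊤ := by
    intro h
    have h1 : (1 : R) ∈ Ideal.span {f} := h ▸ Submodule.mem_top
    obtain ⟨g, hg⟩ := Ideal.mem_span_singleton'.1 h1
    exact hf g hg
  obtain ⟨M, hM, hle⟩ := Ideal.exists_le_maximal _ hne
  have hclosed : IsClosed (M : Set R) := Ideal.IsMaximal.isClosed
  have h1 : (1 : R) ∉ M := (Ideal.ne_top_iff_one M).1 hM.ne_top
  have : Nontrivial (R ⧸ (M : Submodule R R)) :=
    Submodule.Quotient.nontrivial_iff.2 hM.ne_top
  -- Centrality of `z` is what makes multiplication by it left `R`-linear, hence defined modulo `M`.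
  let mulz : R →ₗ[R] R :=
    { toFun := fun x => z * x
      map_add' := fun x y => mul_add z x y
      map_smul' := fun r x => by simp only [smul_eq_mul, RingHom.id_apply, ← mul_assoc, hz r] }
  have hmulz : M ≤ Submodule.comap mulz M := fun x hx => M.mul_mem_left z hx
  let L : (R ⧸ (M : Submodule R R)) →ₗ[R] (R ⧸ (M : Submodule R R)) := Submodule.mapQ M M mulz hmulz
  let T : (R ⧸ (M : Submodule R R)) →L[ℂ] (R ⧸ (M : Submodule R R)) :=
    LinearMap.mkContinuous (L.restrictScalars ℂ) ‖z‖ (by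
      intro x
      refine le_of_forall_pos_le_add fun ε hε => ?_
      have hδ : 0 < ε / (‖z‖ + 1) := by positivity
      obtain ⟨m, rfl, hm⟩ := Submodule.Quotient.norm_mk_lt x hδ
      have h2 : (L.restrictScalars ℂ) (Submodule.Quotient.mk m)
          = Submodule.Quotient.mk (z * m) := rfl
      rw [h2]
      calc ‖(Submodule.Quotient.mk (z * m) : R ⧸ (M : Submodule R R))‖ ≤ ‖z * m‖ :=
            Submodule.Quotient.norm_mk_le _ _
        _ ≤ ‖z‖ * ‖m‖ := norm_mul_le _ _
        _ ≤ ‖z‖ * (‖(Submodule.Quotient.mk m : R ⧸ (M : Submodule R R))‖ + ε / (‖z‖ + 1)) := by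
            gcongr
        _ ≤ _ := by
            rw [mul_add]
            gcongr
            rw [mul_div_assoc', div_le_iff₀ (by positivity)]
            nlinarith [norm_nonneg z])
  have hT : ∀ x : R, T (Submodule.Quotient.mk x) = Submodule.Quotient.mk (z * x) := fun x => rfl
  obtain ⟨μ, hμ⟩ := spectrum.nonempty T
  refine ⟨M, μ, hclosed, h1, hle (Ideal.subset_span rfl), ?_⟩
  by_contra hnot
  apply hμ
  -- Schur's lemma by hand: if `w = z - μ ∉ M`, maximality writes `1` as an element of `M` plus a
  -- left multiple of `x` (injectivity) or of `w` (surjectivity), and the open mapping theorem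
  -- supplies a bounded inverse.
  have hneg : IsUnit (T - algebraMap ℂ _ μ) := by
    set w : R := z - algebraMap ℂ R μ with hw
    have hwc : ∀ x, w * x = x * w := fun x => by
      rw [hw, sub_mul, mul_sub, hz, Algebra.commutes]
    have hS : ∀ x : R, (T - algebraMap ℂ _ μ) (Submodule.Quotient.mk x)
        = Submodule.Quotient.mk (w * x) := by
      intro x
      rw [sub_apply, hT, Algebra.algebraMap_eq_smul_one,
        smul_apply, one_apply_eq_self, hw, sub_mul,
        Submodule.Quotient.mk_sub, ← Submodule.Quotient.mk_smul, Algebra.algebraMap_eq_smul_one,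
        smul_mul_assoc, one_mul]
    rw [ContinuousLinearMap.isUnit_iff_bijective]
    constructor
    · rw [injective_iff_map_eq_zero]
      intro x hx
      obtain ⟨x, rfl⟩ := Submodule.Quotient.mk_surjective _ x
      rw [hS, Submodule.Quotient.mk_eq_zero] at hx
      rw [Submodule.Quotient.mk_eq_zero]
      by_contra hxM
      obtain ⟨y, hy, s, hs, hys⟩ := Submodule.mem_sup.1
        (show (1 : R) ∈ M ⊔ Ideal.span {x} by
          rw [hM.1.2 (M ⊔ Ideal.span {x}) (lt_of_le_of_ne le_sup_left fun h =>
            hxM (h ▸ (le_sup_right (a := M) (Ideal.subset_span rfl : x ∈ Ideal.span {x}))))]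
          trivial)
      obtain ⟨c, rfl⟩ := Ideal.mem_span_singleton'.1 hs
      apply hnot
      have : w = w * y + c * (w * x) := by
        rw [← mul_assoc c, ← hwc c, mul_assoc, ← mul_add, hys, mul_one]
      rw [this]
      exact M.add_mem (M.mul_mem_left _ hy) (M.mul_mem_left _ hx)
    · intro y
      obtain ⟨y, rfl⟩ := Submodule.Quotient.mk_surjective _ y
      obtain ⟨m, hm, s, hs, hms⟩ := Submodule.mem_sup.1
        (show (1 : R) ∈ M ⊔ Ideal.span {w} by
          rw [hM.1.2 (M ⊔ Ideal.span {w}) (lt_of_le_of_ne le_sup_left fun h =>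
            hnot (h ▸ (le_sup_right (a := M) (Ideal.subset_span rfl : w ∈ Ideal.span {w}))))]
          trivial)
      obtain ⟨c, rfl⟩ := Ideal.mem_span_singleton'.1 hs
      refine ⟨Submodule.Quotient.mk (y * c), ?_⟩
      rw [hS, Submodule.Quotient.eq]
      have : w * (y * c) - y = -(y * m) := by
        rw [hwc, mul_assoc, eq_neg_iff_add_eq_zero, sub_add_eq_add_sub, ← mul_add, add_comm (c * w),
          hms, mul_one, sub_self]
      rw [this]
      exact M.neg_mem (M.mul_mem_left _ hm)
  change IsUnit (algebraMap ℂ _ μ - T)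
  rw [← neg_sub]
  exact hneg.neg

/-! ### Growth of weights and the radii `rho1`, `rho2` -/

/-- Subexponential growth in the positive direction. -/
def Subexponential (ω : ℤ → ℝ) : Prop :=
  ∀ r : ℝ, 1 < r → ∃ B : ℝ, 0 < B ∧ ∀ n : ℕ, ω n ≤ B * r ^ n

theorem le_of_pow_le_const_mul_pow {x y C : ℝ} (hy : 0 < y)
    (h : ∀ n : ℕ, x ^ n ≤ C * y ^ n) : x ≤ y := by
  by_contra! hxy
  have h1 : 1 < x / y := (one_lt_div hy).2 hxy
  obtain ⟨n, hn⟩ := pow_unbounded_of_one_lt C h1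
  rw [div_pow, lt_div_iff₀ (by positivity)] at hn
  exact absurd (h n) (not_le.2 hn)

theorem exists_le_pow_of_subexponential {ω : ℤ → ℝ} (h : Subexponential ω) {r : ℝ} (hr : 1 < r) :
    ∃ n : ℕ+, ω ((n : ℕ) : ℤ) ≤ r ^ (n : ℕ) := by
  by_contra! hcon
  have h1 : 1 < Real.sqrt r := by rw [Real.lt_sqrt] <;> simp [hr]
  obtain ⟨B, hB, hb⟩ := h _ h1
  have h2 : Real.sqrt r * Real.sqrt r = r := Real.mul_self_sqrt (by linarith)
  -- The hypothesis for contradiction covers only `n ≥ 1`; `max B 1` takes care of `n = 0`.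
  have : r ≤ Real.sqrt r := le_of_pow_le_const_mul_pow (C := max B 1) (by linarith) fun n => by
    rcases Nat.eq_zero_or_pos n with rfl | hn
    · simp
    · calc r ^ n ≤ ω n := (hcon ⟨n, hn⟩).le
        _ ≤ B * Real.sqrt r ^ n := hb n
        _ ≤ _ := by gcongr; exact le_max_left _ _
  nlinarith

theorem IsWeight.pow_bound {ω : ℤ → ℝ} (h : IsWeight ω) (m j : ℕ) (k : ℕ) :
    ω ((m * k + j : ℕ) : ℤ) ≤ ω m ^ k * ω j := by
  have h0 : ∀ n, 0 ≤ ω n := fun n => zero_le_one.trans (h.one_le n)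
  induction k with
  | zero => simp
  | succ k ih =>
    calc ω ((m * (k + 1) + j : ℕ) : ℤ) = ω ((m : ℤ) + ((m * k + j : ℕ) : ℤ)) := by
          congr 1; push_cast; ring
      _ ≤ ω m * (ω m ^ k * ω j) := (h.submul _ _).trans (mul_le_mul_of_nonneg_left ih (h0 _))
      _ = _ := by ring

/-- Fekete's argument: one good index `m` controls all `n` by division with remainder, the finitely
many remainders being absorbed in the constant. -/
theorem IsWeight.subexponential {ω : ℤ → ℝ} (h : IsWeight ω)
    (hr : ∀ r : ℝ, 1 < r → ∃ n : ℕ+, ω ((n : ℕ) : ℤ) ≤ r ^ (n : ℕ)) : Subexponential ω := by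
  intro r hr1
  obtain ⟨m, hm⟩ := hr r hr1
  have h0 : ∀ n, 0 ≤ ω n := fun n => zero_le_one.trans (h.one_le n)
  refine ⟨∑ j ∈ Finset.range m, ω j + 1, add_pos_of_nonneg_of_pos
    (Finset.sum_nonneg fun _ _ => h0 _) one_pos, fun n => ?_⟩
  have hn : n = m * (n / m) + n % m := (Nat.div_add_mod n m).symm
  have hj : ω ((n % m : ℕ) : ℤ) ≤ ∑ j ∈ Finset.range m, ω j + 1 :=
    (Finset.single_le_sum (f := fun j : ℕ => ω j) (fun _ _ => h0 _)
      (Finset.mem_range.2 (Nat.mod_lt n m.pos))).trans (by linarith)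
  calc ω n = ω ((m * (n / m) + n % m : ℕ) : ℤ) := by rw [← hn]
    _ ≤ ω (m : ℕ) ^ (n / m) * ω ((n % m : ℕ) : ℤ) := h.pow_bound _ _ _
    _ ≤ (r ^ (m : ℕ)) ^ (n / m) * (∑ j ∈ Finset.range m, ω j + 1) := by
        gcongr
        · exact h0 _
        · exact h0 _
    _ = r ^ ((m : ℕ) * (n / m)) * (∑ j ∈ Finset.range m, ω j + 1) := by rw [pow_mul]
    _ ≤ r ^ n * (∑ j ∈ Finset.range m, ω j + 1) := by
        have : 0 ≤ ∑ j ∈ Finset.range m, ω j := Finset.sum_nonneg fun _ _ => h0 _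
        gcongr
        · exact hr1.le
        · exact Nat.mul_div_le n m
    _ = _ := mul_comm _ _

theorem rpow_one_div_le_iff {x r : ℝ} (hx : 0 ≤ x) (hr : 0 ≤ r) (n : ℕ+) :
    x ^ (1 / ((n : ℕ) : ℝ)) ≤ r ↔ x ≤ r ^ (n : ℕ) := by
  rw [one_div, Real.rpow_inv_le_iff_of_pos hx hr (by exact_mod_cast n.pos), Real.rpow_natCast]

/-- All terms of the infimum are at least `1`, so it equals `1` exactly when some term falls below
each `r > 1`. -/
theorem rho2_eq_one_iff {ω : ℤ → ℝ} (h : ∀ n, 1 ≤ ω n) :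
    rho2 ω = 1 ↔ ∀ r : ℝ, 1 < r → ∃ n : ℕ+, ω ((n : ℕ) : ℤ) ≤ r ^ (n : ℕ) := by
  have hone : ∀ n : ℕ+, 1 ≤ ω ((n : ℕ) : ℤ) ^ (1 / ((n : ℕ) : ℝ)) := fun n =>
    Real.one_le_rpow (h _) (by positivity)
  constructor
  · intro heq r hr
    obtain ⟨n, hn⟩ := exists_lt_of_ciInf_lt (show (⨅ n : ℕ+, _) < r from heq.trans_lt hr)
    exact ⟨n, (rpow_one_div_le_iff (zero_le_one.trans (h _)) (by linarith) n).1 hn.le⟩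
  · intro hr
    refine le_antisymm (le_of_forall_gt_imp_ge_of_dense fun r hr1 => ?_) (le_ciInf hone)
    obtain ⟨n, hn⟩ := hr r hr1
    exact (ciInf_le ⟨1, by rintro _ ⟨n, rfl⟩; exact hone n⟩ n).trans
      ((rpow_one_div_le_iff (zero_le_one.trans (h _)) (by linarith) n).2 hn)

theorem rho1_eq_one_iff_rho2 {ω : ℤ → ℝ} (h : ∀ n, 1 ≤ ω n) :
    rho1 ω = 1 ↔ rho2 (fun n => ω (-n)) = 1 := by
  have hone : ∀ n : ℕ+, 1 ≤ ω (-((n : ℕ) : ℤ)) ^ (1 / ((n : ℕ) : ℝ)) := fun n =>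
    Real.one_le_rpow (h _) (by positivity)
  have hinv : ∀ n : ℕ+, ω (-((n : ℕ) : ℤ)) ^ (-(1 / ((n : ℕ) : ℝ)))
      = (ω (-((n : ℕ) : ℤ)) ^ (1 / ((n : ℕ) : ℝ)))⁻¹ := fun n =>
    Real.rpow_neg (zero_le_one.trans (h _)) _
  have hle : ∀ n : ℕ+, ω (-((n : ℕ) : ℤ)) ^ (-(1 / ((n : ℕ) : ℝ))) ≤ 1 := fun n => by
    rw [hinv]; exact inv_le_one_of_one_le₀ (hone n)
  rw [rho2_eq_one_iff fun n => h _]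
  constructor
  · intro heq r hr
    obtain ⟨n, hn⟩ := exists_lt_of_lt_ciSup
      (show r⁻¹ < (⨆ n : ℕ+, _) from (inv_lt_one_of_one_lt₀ hr).trans_eq heq.symm)
    refine ⟨n, (rpow_one_div_le_iff (zero_le_one.trans (h _)) (by linarith) n).1 ?_⟩
    rw [hinv] at hn
    exact ((inv_lt_inv₀ (by linarith) (by linarith [hone n])).1 hn).le
  · intro hr
    refine le_antisymm (ciSup_le hle) (le_of_forall_lt_imp_le_of_dense fun s hs => ?_)
    rcases le_or_gt s 0 with hs0 | hs0
    · refine hs0.trans ((Real.rpow_nonneg (zero_le_one.trans (h _)) _).trans (le_ciSup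
        (f := fun n : ℕ+ => ω (-((n : ℕ) : ℤ)) ^ (-(1 / ((n : ℕ) : ℝ)))) ⟨1, ?_⟩ 1))
      rintro _ ⟨n, rfl⟩; exact hle n
    · obtain ⟨n, hn⟩ := hr s⁻¹ ((one_lt_inv₀ hs0).2 hs)
      refine le_trans ?_ (le_ciSup
        (f := fun n : ℕ+ => ω (-((n : ℕ) : ℤ)) ^ (-(1 / ((n : ℕ) : ℝ)))) ⟨1, ?_⟩ n)
      · simp only [hinv]
        rw [le_inv_comm₀ hs0 (by linarith [hone n])]
        exact (rpow_one_div_le_iff (zero_le_one.trans (h _)) (by positivity) n).2 hn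
      · rintro _ ⟨n, rfl⟩; exact hle n

theorem IsWeight.neg {ω : ℤ → ℝ} (h : IsWeight ω) : IsWeight fun n => ω (-n) :=
  ⟨fun _ => h.one_le _, fun m n => by simpa [neg_add_rev, add_comm] using h.submul (-m) (-n)⟩

/-- A weight that fails to have subexponential growth grows exponentially. -/
theorem exists_pow_le_of_rho2_ne_one {ω : ℤ → ℝ} (h : ∀ n, 1 ≤ ω n) (hρ : rho2 ω ≠ 1) :
    ∃ r : ℝ, 1 < r ∧ ∀ n : ℕ, r ^ n ≤ ω n := by
  rw [ne_eq, rho2_eq_one_iff h] at hρ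
  push Not at hρ
  obtain ⟨r, hr, hn⟩ := hρ
  refine ⟨r, hr, fun n => ?_⟩
  rcases Nat.eq_zero_or_pos n with rfl | hpos
  · simpa using h 0
  · exact (hn ⟨n, hpos⟩).le

/-! ### Construction of admissible weights -/

/-- Rescaling a function that satisfies the conditions on an admissible almost monotone algebra
weight up to constants gives such a weight. -/
theorem exists_scaled_weight {q : ℝ} (hq : 1 ≤ q) {ν : ℤ → ℝ} {C K : ℝ} (hC : 1 ≤ C)
    (hK : 0 < K) (h1 : ∀ n, 1 ≤ ν n) (hsub : ∀ m n, ν (m + n) ≤ C * (ν m * ν n))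
    (hsum : Summable fun n => ν n ^ (-q))
    (hconv : ∀ n, ∃ u : ℤ → ℝ, Summable u ∧ (∀ k, ν k ^ (-q) * ν (n - k) ^ (-q) ≤ u k) ∧
      ∑' k, u k ≤ C * ν n ^ (-q))
    (hleft : ∀ n k : ℤ, n < 0 → k < 0 → ν n ≤ K * ν (n + k))
    (hright : ∀ n k : ℤ, 0 ≤ n → 0 ≤ k → ν n ≤ K * ν (n + k))
    (hg2 : Subexponential ν) (hg1 : Subexponential fun n => ν (-n)) :
    IsAlmostMonotoneAlgebraWeight q (fun n => C * ν n) ∧ IsAdmissible (fun n => C * ν n) := by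
  have h0 : ∀ n, 0 < ν n := fun n => zero_lt_one.trans_le (h1 n)
  have hC0 : 0 < C := by linarith
  have hone : ∀ n, 1 ≤ C * ν n := fun n => one_le_mul_of_one_le_of_one_le hC (h1 n)
  have hpow : ∀ n, (C * ν n) ^ (-q) = C ^ (-q) * ν n ^ (-q) := fun n =>
    Real.mul_rpow hC0.le (h0 n).le
  have hw : IsWeight fun n => C * ν n := ⟨hone, fun m n => by
    calc C * ν (m + n) ≤ C * (C * (ν m * ν n)) := by gcongr; exact hsub m n
      _ = _ := by ring⟩
  have hgrow : ∀ ω : ℤ → ℝ, Subexponential ω → Subexponential fun n => C * ω n := by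
    intro ω h r hr
    obtain ⟨B, hB, hb⟩ := h r hr
    refine ⟨C * B, by positivity, fun n => ?_⟩
    rw [mul_assoc]
    exact mul_le_mul_of_nonneg_left (hb n) hC0.le
  -- The convolution gains two factors `C ^ (-q)`; one is needed on the right, and the other pays
  -- for the constant `C` because `q ≥ 1`.
  have hCq : C ^ (-q) * C ≤ 1 := by
    rw [← Real.rpow_add_one hC0.ne']
    exact Real.rpow_le_one_of_one_le_of_nonpos hC (by linarith)
  refine ⟨{ hw with summable := ?_, conv_le := ?_, left_monotone := ?_, right_monotone := ?_ },
    { hw with rho1_eq := ?_, rho2_eq := ?_ }⟩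
  · simp only [hpow]
    exact hsum.mul_left _
  · intro n
    obtain ⟨u, hu, hle, htot⟩ := hconv n
    simp only [hpow]
    have hs : Summable fun k => ν k ^ (-q) * ν (n - k) ^ (-q) :=
      hu.of_nonneg_of_le (fun k => mul_nonneg (Real.rpow_nonneg (h0 _).le _)
        (Real.rpow_nonneg (h0 _).le _)) hle
    calc ∑' k, C ^ (-q) * ν k ^ (-q) * (C ^ (-q) * ν (n - k) ^ (-q))
        = C ^ (-q) * C ^ (-q) * ∑' k, ν k ^ (-q) * ν (n - k) ^ (-q) := by
          rw [← tsum_mul_left]; exact tsum_congr fun k => by ring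
      _ ≤ C ^ (-q) * C ^ (-q) * (C * ν n ^ (-q)) := by
          gcongr
          exact (hs.tsum_le_tsum hle hu).trans htot
      _ = (C ^ (-q) * C) * (C ^ (-q) * ν n ^ (-q)) := by ring
      _ ≤ _ := mul_le_of_le_one_left (mul_nonneg (Real.rpow_nonneg hC0.le _)
          (Real.rpow_nonneg (h0 _).le _)) hCq
  · refine fun _ => ⟨K, hK, fun n k hn hk => ?_⟩
    rw [mul_left_comm]
    gcongr
    exact hleft n k hn hk
  · refine fun _ => ⟨K, hK, fun n k hn hk => ?_⟩
    rw [mul_left_comm]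
    gcongr
    exact hright n k hn hk
  · rw [rho1_eq_one_iff_rho2 hone, rho2_eq_one_iff fun n => hone _]
    exact fun r hr => exists_le_pow_of_subexponential (hgrow _ hg1) hr
  · rw [rho2_eq_one_iff hone]
    exact fun r hr => exists_le_pow_of_subexponential (hgrow _ hg2) hr

/-- The symmetric extension of the positive half of an almost monotone algebra weight of
subexponential growth. -/
theorem exists_symmetric_weight {q : ℝ} (hq : 1 ≤ q) {ω : ℤ → ℝ} (hω : IsWeight ω)
    (hsum : Summable fun n => ω n ^ (-q))
    (hconv : ∀ n : ℤ, ∑' k : ℤ, ω k ^ (-q) * ω (n - k) ^ (-q) ≤ ω n ^ (-q))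
    {K : ℝ} (hmono : ∀ n k : ℕ, ω n ≤ K * ω (n + k)) (hg : Subexponential ω) :
    ∃ C : ℝ, 0 < C ∧ IsAlmostMonotoneAlgebraWeight q (fun n => C * ω |n|) ∧
      IsAdmissible (fun n => C * ω |n|) := by
  have h0 : ∀ n, 0 < ω n := fun n => zero_lt_one.trans_le (hω.one_le n)
  have hp0 : ∀ n, 0 < ω n ^ (-q) := fun n => Real.rpow_pos_of_pos (h0 n) _
  have hK : 1 ≤ K := by
    have := hmono 0 0
    simp only [Nat.cast_zero, add_zero] at this
    by_contra! hlt
    nlinarith [h0 0]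
  have hmono' : ∀ m n : ℤ, |m| ≤ |n| → ω |m| ≤ K * ω |n| := by
    intro m n hmn
    rw [Int.abs_eq_natAbs, Int.abs_eq_natAbs, Nat.cast_le] at hmn
    have := hmono m.natAbs (n.natAbs - m.natAbs)
    rw [← Nat.cast_add, Nat.add_sub_cancel' hmn] at this
    simpa only [Int.natCast_natAbs] using this
  have hmono'' : ∀ m n : ℤ, |m| ≤ |n| → ω |n| ^ (-q) ≤ K ^ q * ω |m| ^ (-q) := by
    intro m n hmn
    have h2 : (K * ω |n|) ^ (-q) ≤ ω |m| ^ (-q) :=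
      Real.rpow_le_rpow_of_nonpos (h0 _) (hmono' m n hmn) (by linarith)
    rw [Real.mul_rpow (by linarith) (h0 _).le, Real.rpow_neg (by linarith),
      inv_mul_le_iff₀ (Real.rpow_pos_of_pos (by linarith) _)] at h2
    exact h2
  have hsumν : Summable fun n : ℤ => ω |n| ^ (-q) := by
    rw [summable_int_iff_summable_nat_and_neg]
    simp only [abs_neg, Nat.abs_cast, and_self]
    exact (summable_int_iff_summable_nat_and_neg.1 hsum).1
  have hprod : ∀ n : ℤ, Summable fun k => ω k ^ (-q) * ω (n - k) ^ (-q) := fun n =>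
    hsum.of_nonneg_of_le (fun k => (mul_pos (hp0 _) (hp0 _)).le) fun k =>
      mul_le_of_le_one_right (hp0 _).le
        (Real.rpow_le_one_of_one_le_of_nonpos (hω.one_le _) (by linarith))
  set S := ∑' n : ℤ, ω |n| ^ (-q) with hS
  have hS0 : 0 ≤ S := tsum_nonneg fun n => (hp0 _).le
  have hKq : 0 ≤ K ^ q := Real.rpow_nonneg (by linarith) _
  -- The first entry serves submultiplicativity, the second the convolution inequality.
  set C := max K (1 + K ^ q * (S + S)) with hCdef
  have hC : 1 ≤ C := hK.trans (le_max_left _ _)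
  have hpos : ∀ n : ℤ, 0 ≤ n → ∃ u : ℤ → ℝ, Summable u ∧
      (∀ k, ω |k| ^ (-q) * ω |n - k| ^ (-q) ≤ u k) ∧ ∑' k, u k ≤ C * ω |n| ^ (-q) := by
    intro n hn
    have hsh : Summable fun k : ℤ => ω |n - k| ^ (-q) :=
      (Equiv.subLeft n).summable_iff.2 hsumν
    have hsht : ∑' k : ℤ, ω |n - k| ^ (-q) = S :=
      (Equiv.subLeft n).tsum_eq (fun k : ℤ => ω |k| ^ (-q))
    have hs2 := (hsumν.add hsh).mul_left (K ^ q * ω |n| ^ (-q))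
    -- For `0 ≤ k ≤ n` the term already occurs in the convolution for `ω`. Otherwise `|n - k|` or
    -- `|k|` exceeds `n`, and almost monotonicity extracts the factor `K ^ q * ω |n| ^ (-q)`.
    refine ⟨_, (hprod n).add hs2, fun k => ?_, ?_⟩
    · have a1 := hp0 |k|
      have a2 := hp0 |n - k|
      have a3 := hp0 |n|
      have a4 := (mul_pos (hp0 k) (hp0 (n - k))).le
      have a5 := mul_nonneg hKq a3.le
      rcases lt_or_ge k 0 with hk | hk
      · have := mul_le_mul_of_nonneg_left (hmono'' n (n - k) (by
          rw [abs_of_nonneg hn, abs_of_nonneg (by omega)]; omega)) a1.le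
        nlinarith [mul_nonneg a5 a2.le]
      · rcases lt_or_ge n k with hk2 | hk2
        · have := mul_le_mul_of_nonneg_right (hmono'' n k (by
            rw [abs_of_nonneg hn, abs_of_nonneg (by omega)]; omega)) a2.le
          nlinarith [mul_nonneg a5 a1.le]
        · rw [abs_of_nonneg hk, abs_of_nonneg (sub_nonneg.2 hk2)]
          have := mul_nonneg a5 (add_pos (hp0 k) (hp0 (n - k))).le
          linarith
    · rw [(hprod n).tsum_add hs2, tsum_mul_left, hsumν.tsum_add hsh, hsht, ← hS]
      have := hconv n
      rw [abs_of_nonneg hn]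
      calc _ ≤ ω n ^ (-q) + K ^ q * ω n ^ (-q) * (S + S) := by linarith
        _ = (1 + K ^ q * (S + S)) * ω n ^ (-q) := by ring
        _ ≤ _ := by
          gcongr
          · exact (hp0 n).le
          · exact le_max_right _ _
  refine ⟨C, by linarith, exists_scaled_weight (K := K) hq hC (by linarith)
    (fun n => hω.one_le _) ?_ hsumν ?_ ?_ ?_ ?_ ?_⟩
  · intro m n
    have hmul : ∀ a b : ℤ, ω |a + b| ≤ K * (ω |a| * ω |b|) := by
      intro a b
      have ha := h0 |a|
      have hb := h0 |b|
      have ha1 := hω.one_le |a|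
      have hb1 := hω.one_le |b|
      -- Almost monotonicity suffices unless `|a + b|` exceeds both `|a|` and `|b|`; then the signs
      -- agree and submultiplicativity on the positive half applies.
      rcases le_or_gt |a + b| |a| with h | h
      · refine (hmono' _ _ h).trans (mul_le_mul_of_nonneg_left ?_ (by linarith))
        exact le_mul_of_one_le_right ha.le hb1
      · rcases le_or_gt |a + b| |b| with h' | h'
        · refine (hmono' _ _ h').trans (mul_le_mul_of_nonneg_left ?_ (by linarith))
          exact le_mul_of_one_le_left hb.le ha1
        · have : |a + b| = |a| + |b| := by
            rcases abs_cases a with ha | ha <;> rcases abs_cases b with hb | hb <;>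
              rcases abs_cases (a + b) with hc | hc <;> omega
          rw [this]
          exact (hω.submul _ _).trans (le_mul_of_one_le_left (by positivity) hK)
    refine (hmul m n).trans ?_
    gcongr
    · exact (mul_pos (h0 _) (h0 _)).le
    · exact le_max_left _ _
  · intro n
    rcases le_or_gt 0 n with hn | hn
    · exact hpos n hn
    · obtain ⟨u, hu, hle, htot⟩ := hpos (-n) (by omega)
      refine ⟨fun k => u (-k), (Equiv.neg ℤ).summable_iff.2 hu, fun k => ?_, ?_⟩
      · have := hle (-k)
        rwa [abs_neg, neg_sub_neg, ← neg_sub n k, abs_neg] at this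
      · rw [abs_neg] at htot
        exact ((Equiv.neg ℤ).tsum_eq u).trans_le htot
  · intro n k hn hk
    exact hmono' _ _ (by rw [abs_of_neg hn, abs_of_neg (by omega)]; omega)
  · intro n k hn hk
    exact hmono' _ _ (by rw [abs_of_nonneg hn, abs_of_nonneg (by omega)]; omega)
  · simpa only [Subexponential, Nat.abs_cast] using hg
  · simpa only [Subexponential, abs_neg, Nat.abs_cast] using hg

theorem subexponential_sq : Subexponential fun n : ℤ => (1 + |(n : ℝ)|) ^ 2 := by
  intro r hr
  have hlim := tendsto_pow_const_mul_const_pow_of_abs_lt_one 2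
    (show |r⁻¹| < 1 by
      rw [abs_of_pos (by positivity)]; exact inv_lt_one_of_one_lt₀ hr)
  obtain ⟨B, hB⟩ := ((Filter.tendsto_add_atTop_iff_nat 1).2 hlim).bddAbove_range
  refine ⟨max B 1 * r, by positivity, fun n => ?_⟩
  have := hB ⟨n, rfl⟩
  simp only [inv_pow] at this
  rw [← div_eq_mul_inv, div_le_iff₀ (by positivity)] at this
  push_cast at this ⊢
  rw [Nat.abs_cast, add_comm]
  refine this.trans ?_
  rw [mul_assoc, ← pow_succ']
  gcongr
  exact le_max_left _ _

/-- A constant multiple of `(1 + |n|)²` is an admissible almost monotone algebra weight. -/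
theorem exists_polynomial_weight {q : ℝ} (hq : 1 ≤ q) :
    ∃ C : ℝ, 0 < C ∧ IsAlmostMonotoneAlgebraWeight q (fun n => C * (1 + |(n : ℝ)|) ^ 2) ∧
      IsAdmissible (fun n => C * (1 + |(n : ℝ)|) ^ 2) := by
  set ν : ℤ → ℝ := fun n => (1 + |(n : ℝ)|) ^ 2 with hν
  have h1 : ∀ n, 1 ≤ ν n := fun n => one_le_pow₀ (by linarith [abs_nonneg (n : ℝ)])
  have h0 : ∀ n, 0 < ν n := fun n => zero_lt_one.trans_le (h1 n)
  have hp0 : ∀ n, 0 < ν n ^ (-q) := fun n => Real.rpow_pos_of_pos (h0 n) _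
  have habs : ∀ m n : ℤ, |((m + n : ℤ) : ℝ)| ≤ |(m : ℝ)| + |(n : ℝ)| := fun m n => by
    push_cast; exact abs_add_le _ _
  have hsum : Summable fun n => ν n ^ (-q) := by
    have hnat : Summable fun n : ℕ => (1 + (n : ℝ)) ^ (-(2 : ℝ)) := by
      have := (summable_nat_add_iff 1).2 (Real.summable_nat_rpow.2 (show -(2 : ℝ) < -1 by norm_num))
      simpa [add_comm] using this
    have hle : ∀ n : ℤ, ν n ^ (-q) ≤ (1 + |(n : ℝ)|) ^ (-(2 : ℝ)) := fun n => by
      have hb : 1 ≤ 1 + |(n : ℝ)| := by linarith [abs_nonneg (n : ℝ)]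
      have : ν n = (1 + |(n : ℝ)|) ^ (2 : ℝ) := by rw [hν]; norm_cast
      rw [this, ← Real.rpow_mul (by linarith)]
      exact Real.rpow_le_rpow_of_exponent_le hb (by linarith)
    refine Summable.of_nonneg_of_le (fun n => (hp0 n).le) hle ?_
    rw [summable_int_iff_summable_nat_and_neg]
    simpa using hnat
  set S := ∑' n : ℤ, ν n ^ (-q) with hS
  have hS0 : 0 ≤ S := tsum_nonneg fun n => (hp0 _).le
  have h4 : (0 : ℝ) ≤ 4 ^ q := Real.rpow_nonneg (by norm_num) _
  -- The larger of two summands has at least half the absolute value of the sum; squaring gives the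
  -- constant `4`.
  have hmax : ∀ a b : ℤ, |(a : ℝ)| ≤ |(b : ℝ)| → ν a ^ (-q) * ν b ^ (-q) ≤
      4 ^ q * ν (a + b) ^ (-q) * ν a ^ (-q) := by
    intro a b hab
    have h2 : ν (a + b) ≤ 4 * ν b := by
      have := habs a b
      simp only [hν]
      nlinarith [abs_nonneg ((a + b : ℤ) : ℝ), abs_nonneg (b : ℝ)]
    have h3 : (4 * ν b) ^ (-q) ≤ ν (a + b) ^ (-q) :=
      Real.rpow_le_rpow_of_nonpos (h0 _) h2 (by linarith)
    rw [Real.mul_rpow (by norm_num) (h0 _).le, Real.rpow_neg (by norm_num),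
      inv_mul_le_iff₀ (Real.rpow_pos_of_pos (by norm_num) _)] at h3
    rw [mul_comm]
    exact mul_le_mul_of_nonneg_right h3 (hp0 a).le
  set C := max 1 (4 ^ q * (S + S)) with hCdef
  have hC : 1 ≤ C := le_max_left _ _
  refine ⟨C, by linarith, exists_scaled_weight (K := 1) hq hC one_pos h1 ?_ hsum ?_ ?_ ?_
    subexponential_sq ?_⟩
  · intro m n
    refine le_trans ?_ (le_mul_of_one_le_left (mul_pos (h0 m) (h0 n)).le hC)
    simp only [← mul_pow]
    gcongr
    nlinarith [habs m n, abs_nonneg (m : ℝ), abs_nonneg (n : ℝ),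
      mul_nonneg (abs_nonneg (m : ℝ)) (abs_nonneg (n : ℝ))]
  · intro n
    have hsh : Summable fun k : ℤ => ν (n - k) ^ (-q) :=
      (Equiv.subLeft n).summable_iff.2 hsum
    have hsht : ∑' k : ℤ, ν (n - k) ^ (-q) = S :=
      (Equiv.subLeft n).tsum_eq (fun k : ℤ => ν k ^ (-q))
    refine ⟨_, (hsum.add hsh).mul_left (4 ^ q * ν n ^ (-q)), fun k => ?_, ?_⟩
    · have a1 := mul_nonneg (mul_nonneg h4 (hp0 n).le) (hp0 k).le
      have a2 := mul_nonneg (mul_nonneg h4 (hp0 n).le) (hp0 (n - k)).le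
      rcases le_total |(k : ℝ)| |((n - k : ℤ) : ℝ)| with h | h
      · have := hmax _ _ h
        rw [add_sub_cancel] at this
        linarith
      · have := hmax _ _ h
        rw [sub_add_cancel] at this
        linarith
    · rw [tsum_mul_left, hsum.tsum_add hsh, hsht, ← hS]
      calc _ = (4 ^ q * (S + S)) * ν n ^ (-q) := by ring
        _ ≤ _ := by
          gcongr
          exact le_max_right _ _
  · intro n k hn hk
    have hn' : (n : ℝ) < 0 := by exact_mod_cast hn
    have hk' : (k : ℝ) < 0 := by exact_mod_cast hk
    rw [one_mul]
    change (1 + |(n : ℝ)|) ^ 2 ≤ (1 + |((n + k : ℤ) : ℝ)|) ^ 2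
    push_cast
    gcongr ?_ ^ 2
    gcongr 1 + ?_
    rw [abs_of_neg hn', abs_of_neg (by linarith)]
    linarith
  · intro n k hn hk
    have hn' : (0 : ℝ) ≤ n := by exact_mod_cast hn
    have hk' : (0 : ℝ) ≤ k := by exact_mod_cast hk
    rw [one_mul]
    change (1 + |(n : ℝ)|) ^ 2 ≤ (1 + |((n + k : ℤ) : ℝ)|) ^ 2
    push_cast
    gcongr ?_ ^ 2
    gcongr 1 + ?_
    rw [abs_of_nonneg hn', abs_of_nonneg (by linarith)]
    linarith
  · simpa only [hν, Int.cast_neg, abs_neg] using subexponential_sq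

/-- Every almost monotone algebra weight dominates an admissible one. -/
theorem exists_admissible_weight_le {q : ℝ} (hq : 1 ≤ q) {ω : ℤ → ℝ}
    (hω : IsAlmostMonotoneAlgebraWeight q ω) :
    ∃ ν : ℤ → ℝ, IsAlmostMonotoneAlgebraWeight q ν ∧ IsAdmissible ν ∧
      ∃ K : ℝ, 0 < K ∧ ∀ n, ν n ≤ K * ω n := by
  have h0 : ∀ n, 0 < ω n := fun n => zero_lt_one.trans_le (hω.one_le n)
  have hn0 := hω.toIsWeight.neg
  -- The mirrored half costs only a constant: on the negative side `η m ≤ B * r ^ m ≤ B * η (-m)`.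
  have key : ∀ (η : ℤ → ℝ) (r C : ℝ), 0 < C → 1 < r → (∀ n, 0 < η n) → Subexponential η →
      (∀ n : ℕ, r ^ n ≤ η (-n)) →
      ∃ K : ℝ, 0 < K ∧ ∀ n : ℤ, C * η |n| ≤ K * η n := by
    intro η r C hC hr1 h0 hb hr
    obtain ⟨B, hB, hb⟩ := hb r hr1
    refine ⟨C * (B + 1), by positivity, fun n => ?_⟩
    rw [mul_assoc]
    gcongr
    obtain ⟨m, rfl | rfl⟩ := n.eq_nat_or_neg
    · rw [Nat.abs_cast]
      nlinarith [mul_pos hB (h0 m)]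
    · rw [abs_neg, Nat.abs_cast]
      nlinarith [mul_le_mul_of_nonneg_left (hr m) hB.le, hb m, h0 (-m)]
  by_cases hρ2 : rho2 ω = 1 <;> by_cases hρ1 : rho1 ω = 1
  · exact ⟨ω, hω, { hω.toIsWeight with rho1_eq := hρ1, rho2_eq := hρ2 }, 1, one_pos,
      fun n => (one_mul _).ge⟩
  · have hsub := hω.subexponential ((rho2_eq_one_iff hω.one_le).1 hρ2)
    obtain ⟨K, hK, hmono⟩ := hω.right_monotone hρ2
    obtain ⟨C, hC, hν, hadm⟩ := exists_symmetric_weight hq hω.toIsWeight hω.summable hω.conv_le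
      (fun n k => hmono n k (by omega) (by omega)) hsub
    obtain ⟨r, hr1, hr⟩ := exists_pow_le_of_rho2_ne_one hn0.one_le
      (fun h => hρ1 ((rho1_eq_one_iff_rho2 hω.one_le).2 h))
    exact ⟨_, hν, hadm, key ω r C hC hr1 h0 hsub hr⟩
  · have hsub := hn0.subexponential
      ((rho2_eq_one_iff hn0.one_le).1 ((rho1_eq_one_iff_rho2 hω.one_le).1 hρ1))
    obtain ⟨K, hK, hmono⟩ := hω.left_monotone hρ1
    have hsum : Summable fun n => ω (-n) ^ (-q) := (Equiv.neg ℤ).summable_iff.2 hω.summable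
    obtain ⟨C, hC, hν, hadm⟩ := exists_symmetric_weight hq hn0 hsum
      (fun n => by
        refine le_trans (le_of_eq ?_) (hω.conv_le (-n))
        rw [← (Equiv.neg ℤ).tsum_eq]
        refine tsum_congr fun k => ?_
        simp only [Equiv.neg_apply]
        congr 3 <;> ring)
      -- `left_monotone` concerns strictly negative arguments only; the summand `ω 0` covers `n = 0`
      -- and `k = 0`.
      (K := K + ω 0)
      (fun n k => by
        have h1 := h0 (-((n : ℤ) + k))
        have h2 := h0 0
        have h3 := hω.one_le 0
        have h4 := hω.one_le (-((n : ℤ) + k))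
        rcases Nat.eq_zero_or_pos n with rfl | hn
        · rw [Nat.cast_zero, neg_zero] at *
          nlinarith
        · rcases Nat.eq_zero_or_pos k with rfl | hk
          · rw [Nat.cast_zero, add_zero] at *
            nlinarith
          · have := hmono (-n) (-k) (by omega) (by omega)
            rw [← neg_add] at this
            nlinarith) hsub
    obtain ⟨r, hr1, hr⟩ := exists_pow_le_of_rho2_ne_one hω.one_le hρ2
    obtain ⟨K', hK', hle⟩ := key (fun n => ω (-n)) r C hC hr1 (fun n => h0 _) hsub
      (fun n => by simpa using hr n)
    exact ⟨_, hν, hadm, K', hK', fun n => by simpa using hle (-n)⟩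
  · obtain ⟨C, hC, hν, hadm⟩ := exists_polynomial_weight hq
    obtain ⟨r, hr1, hr⟩ := exists_pow_le_of_rho2_ne_one hω.one_le hρ2
    obtain ⟨s, hs1, hs⟩ := exists_pow_le_of_rho2_ne_one hn0.one_le
      (fun h => hρ1 ((rho1_eq_one_iff_rho2 hω.one_le).2 h))
    -- With exponential growth on both sides, the slower of the two rates still dominates a
    -- quadratic.
    obtain ⟨B, hB, hb⟩ := subexponential_sq (min r s) (lt_min hr1 hs1)
    have hpos : 0 < min r s := zero_lt_one.trans (lt_min hr1 hs1)
    refine ⟨_, hν, hadm, C * B, by positivity, fun n => ?_⟩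
    rw [mul_assoc]
    gcongr
    obtain ⟨m, rfl | rfl⟩ := n.eq_nat_or_neg
    · refine (hb m).trans ?_
      gcongr
      exact (pow_le_pow_left₀ hpos.le (min_le_left _ _) m).trans (hr m)
    · rw [Int.cast_neg, abs_neg]
      refine (hb m).trans ?_
      gcongr
      exact (pow_le_pow_left₀ hpos.le (min_le_right _ _) m).trans (hs m)

/-! ### Fourier coefficients and absolutely convergent series -/

section Fourier

variable {A : Type*} [NormedRing A] [NormedAlgebra ℂ A]

theorem continuous_fourier_integrand (f : C(Circle, A)) (n : ℤ) :
    Continuous fun t : ℝ => Complex.exp (-((n : ℂ) * (t : ℂ) * Complex.I)) • f (Circle.exp t) := by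
  have : Continuous fun t : ℝ => Complex.exp (-((n : ℂ) * (t : ℂ) * Complex.I)) := by fun_prop
  exact this.smul (f.continuous.comp Circle.exp.continuous)

theorem fourierCoefficient_add (f g : C(Circle, A)) (n : ℤ) :
    fourierCoefficient (f + g) n = fourierCoefficient f n + fourierCoefficient g n := by
  simp only [fourierCoefficient, ContinuousMap.add_apply, smul_add]
  rw [intervalIntegral.integral_add ((continuous_fourier_integrand f n).intervalIntegrable _ _)
    ((continuous_fourier_integrand g n).intervalIntegrable _ _), smul_add]

theorem fourierCoefficient_smul (c : ℂ) (f : C(Circle, A)) (n : ℤ) :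
    fourierCoefficient (c • f) n = c • fourierCoefficient f n := by
  simp only [fourierCoefficient, ContinuousMap.smul_apply, smul_comm _ c]
  rw [intervalIntegral.integral_smul, smul_comm]

theorem norm_fourierCoefficient_le (f : C(Circle, A)) (n : ℤ) :
    ‖fourierCoefficient f n‖ ≤ 1 * ‖f‖ := by
  have hpi := Real.pi_pos
  have h := intervalIntegral.norm_integral_le_of_norm_le_const (a := 0) (b := 2 * Real.pi)
    (C := ‖f‖) (f := fun t : ℝ =>
      Complex.exp (-((n : ℂ) * (t : ℂ) * Complex.I)) • f (Circle.exp t)) fun t _ => by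
    rw [norm_smul]
    have : ‖Complex.exp (-((n : ℂ) * (t : ℂ) * Complex.I))‖ = 1 := by
      have h2 : -((n : ℂ) * (t : ℂ) * Complex.I) = ((-(n * t) : ℝ) : ℂ) * Complex.I := by
        push_cast; ring
      rw [h2, Complex.norm_exp_ofReal_mul_I]
    rw [this, one_mul]
    exact f.norm_coe_le_norm _
  rw [sub_zero, abs_of_pos (by positivity)] at h
  rw [fourierCoefficient, norm_smul, Complex.norm_real, Real.norm_of_nonneg (by positivity)]
  calc _ ≤ 1 / (2 * Real.pi) * (‖f‖ * (2 * Real.pi)) := by gcongr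
    _ = _ := by field_simp

/-- The `n`-th Fourier coefficient as a bounded linear map. -/
noncomputable def fourierCoefficientL (n : ℤ) : C(Circle, A) →L[ℂ] A :=
  LinearMap.mkContinuous
    { toFun := fun f => fourierCoefficient f n
      map_add' := fun f g => fourierCoefficient_add f g n
      map_smul' := fun c f => fourierCoefficient_smul c f n } 1
    fun f => norm_fourierCoefficient_le f n

theorem fourierCoefficientL_apply (n : ℤ) (f : C(Circle, A)) :
    fourierCoefficientL n f = fourierCoefficient f n := rfl

/-- The bounded linear map taking `a` to the monomial `z ↦ z ^ n • a`. -/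
noncomputable def monomial (n : ℤ) : A →L[ℂ] C(Circle, A) :=
  LinearMap.mkContinuous
    { toFun := fun a => ⟨fun z => ((z ^ n : Circle) : ℂ) • a,
        ((show Continuous fun w : Circle => (w : ℂ) from
          continuous_subtype_val).comp (continuous_zpow n)).smul continuous_const⟩
      map_add' := fun a b => by ext z; simp [smul_add]
      map_smul' := fun c a => by ext z; simp [smul_comm c] } 1
    fun a => by
      rw [one_mul, ContinuousMap.norm_le _ (norm_nonneg _)]
      intro z
      change ‖((z ^ n : Circle) : ℂ) • a‖ ≤ _
      rw [norm_smul, Circle.norm_coe, one_mul]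

theorem monomial_apply (n : ℤ) (a : A) (z : Circle) : monomial n a z = (z : ℂ) ^ n • a := by
  rw [← Circle.coe_zpow]; rfl

theorem norm_monomial_le (n : ℤ) (a : A) : ‖monomial n a‖ ≤ ‖a‖ := by
  rw [ContinuousMap.norm_le _ (norm_nonneg _)]
  intro z
  rw [monomial_apply, ← Circle.coe_zpow, norm_smul, Circle.norm_coe, one_mul]

theorem monomial_mul (m n : ℤ) (a b : A) :
    monomial m a * monomial n b = monomial (m + n) (a * b) := by
  ext z
  rw [ContinuousMap.mul_apply, monomial_apply, monomial_apply, monomial_apply, smul_mul_smul_comm,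
    zpow_add₀ z.coe_ne_zero]

theorem monomial_zero_one : monomial 0 (1 : A) = 1 := by
  ext z
  simp [monomial_apply]

theorem hasSum_apply_of_hasSum_monomial {c : ℤ → A} {f : C(Circle, A)}
    (h : HasSum (fun n => monomial n (c n)) f) (z : Circle) :
    HasSum (fun n : ℤ => (z : ℂ) ^ n • c n) (f z) := by
  simpa [monomial_apply] using (ContinuousMap.evalCLM ℂ z).hasSum h

variable [CompleteSpace A]

theorem fourierCoefficient_monomial (m n : ℤ) (a : A) :
    fourierCoefficient (monomial m a) n = if n = m then a else 0 := by
  have hpi := Real.pi_pos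
  have h1 : ∀ t : ℝ, Complex.exp (-((n : ℂ) * (t : ℂ) * Complex.I)) • monomial m a (Circle.exp t)
      = Complex.exp ((((m - n : ℤ) : ℂ) * Complex.I) * t) • a := by
    intro t
    rw [monomial_apply, smul_smul, Circle.coe_exp, ← Complex.exp_int_mul, ← Complex.exp_add]
    congr 2
    push_cast
    ring
  simp only [fourierCoefficient, h1]
  rw [intervalIntegral.integral_smul_const]
  split_ifs with h
  · subst h
    simp only [sub_self, Int.cast_zero, zero_mul, Complex.exp_zero, intervalIntegral.integral_const,
      sub_zero]
    rw [Complex.real_smul, mul_one, smul_smul, ← Complex.ofReal_mul, one_div_mul_cancel (by positivity),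
      Complex.ofReal_one, one_smul]
  · have hc : (((m - n : ℤ) : ℂ) * Complex.I) ≠ 0 :=
      mul_ne_zero (Int.cast_ne_zero.2 (sub_ne_zero.2 (Ne.symm h))) Complex.I_ne_zero
    rw [integral_exp_mul_complex hc]
    have h2 : ((m - n : ℤ) : ℂ) * Complex.I * ((2 * Real.pi : ℝ) : ℂ)
        = ((m - n : ℤ) : ℂ) * (2 * Real.pi * Complex.I) := by push_cast; ring
    rw [h2, Complex.exp_int_mul_two_pi_mul_I]
    simp

/-- The series converges in the supremum norm, for which the `n`-th coefficient is a bounded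
functional with values in `A`, so it may be applied termwise. -/
theorem fourierCoefficient_eq_of_hasSum {c : ℤ → A} {f : C(Circle, A)}
    (h : HasSum (fun n => monomial n (c n)) f) (n : ℤ) : fourierCoefficient f n = c n := by
  have h1 := (fourierCoefficientL n).hasSum h
  simp only [fourierCoefficientL_apply, fourierCoefficient_monomial] at h1
  simp only [eq_comm (a := n)] at h1
  refine h1.unique ?_
  refine (hasSum_ite_eq n (c n)).congr_fun fun m => ?_
  split_ifs with h <;> simp [h]

theorem exists_hasSum_monomial {c : ℤ → A} (h : Summable fun n => ‖c n‖) :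
    ∃ f : C(Circle, A), HasSum (fun n => monomial n (c n)) f :=
  ⟨_, (Summable.of_norm_bounded h fun n => norm_monomial_le n (c n)).hasSum⟩

theorem hasSum_convolution {R : Type*} [NormedRing R] [CompleteSpace R] {x y : ℤ → R}
    (hx : Summable fun n => ‖x n‖) (hy : Summable fun n => ‖y n‖) :
    (∀ n, Summable fun k => x k * y (n - k)) ∧
      HasSum (fun n => ∑' k, x k * y (n - k)) ((∑' n, x n) * ∑' n, y n) := by
  -- Reindexes the double series by (total degree, first degree).
  let e : ℤ × ℤ ≃ ℤ × ℤ :=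
    { toFun := fun u => (u.2, u.1 - u.2)
      invFun := fun u => (u.1 + u.2, u.1)
      left_inv := fun u => by simp
      right_inv := fun u => by simp }
  have hs := summable_mul_of_summable_norm hx hy
  have h1 : HasSum (fun u : ℤ × ℤ => x u.2 * y (u.1 - u.2)) ((∑' n, x n) * ∑' n, y n) :=
    e.hasSum_iff.2 (hx.of_norm.hasSum.mul hy.of_norm.hasSum hs)
  have h2 : ∀ n, Summable fun k => x k * y (n - k) := fun n => h1.summable.prod_factor n
  exact ⟨h2, h1.prod_fiberwise fun n => (h2 n).hasSum⟩

theorem hasSum_monomial_mul {a b : ℤ → A} {f g : C(Circle, A)}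
    (ha : Summable fun n => ‖a n‖) (hb : Summable fun n => ‖b n‖)
    (hf : HasSum (fun n => monomial n (a n)) f) (hg : HasSum (fun n => monomial n (b n)) g) :
    HasSum (fun n => monomial n (∑' k, a k * b (n - k))) (f * g) := by
  have h := (hasSum_convolution
    (ha.of_nonneg_of_le (fun _ => norm_nonneg _) fun n => norm_monomial_le n (a n))
    (hb.of_nonneg_of_le (fun _ => norm_nonneg _) fun n => norm_monomial_le n (b n))).2
  rw [hf.tsum_eq, hg.tsum_eq] at h
  have hab := (hasSum_convolution ha hb).1
  simpa only [monomial_mul, add_sub_cancel, ContinuousLinearMap.map_tsum _ (hab _)] using h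

end Fourier

/-! ### Hölder's inequality for weighted sequences -/

section Holder

variable {p q : ℝ} {ω : ℤ → ℝ}

/-- Hölder applied to `u = (u ω) · ω⁻¹`, with `ω⁻¹` in `ℓ^q`. -/
theorem summable_of_summable_rpow_mul_weight (hpq : p.HolderConjugate q)
    (hω : IsAlmostMonotoneAlgebraWeight q ω) {u : ℤ → ℝ} (hu : ∀ n, 0 ≤ u n)
    (h : Summable fun n => u n ^ p * ω n ^ p) : Summable u := by
  have h0 : ∀ n, 0 < ω n := fun n => zero_lt_one.trans_le (hω.one_le n)
  have h1 := (Real.summable_and_inner_le_Lp_mul_Lq_tsum_of_nonneg hpq (f := fun n => u n * ω n)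
    (g := fun n => (ω n)⁻¹) (fun n => mul_nonneg (hu n) (h0 n).le) (fun n => (inv_pos.2 (h0 n)).le)
    (by simpa only [Real.mul_rpow (hu _) (h0 _).le] using h)
    (by simpa only [Real.inv_rpow (h0 _).le, ← Real.rpow_neg (h0 _).le] using hω.summable)).1
  refine h1.congr fun n => ?_
  rw [mul_assoc, mul_inv_cancel₀ (h0 n).ne', mul_one]

/-- The source of submultiplicativity: the right side is an ordinary convolution of the weighted
`p`-th powers, whose sum over `n` is a product. Hölder is applied after multiplying and dividing
each term by `ω k * ω (n - k)`. -/
theorem convolution_rpow_le (hpq : p.HolderConjugate q)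
    (hω : IsAlmostMonotoneAlgebraWeight q ω) {u v : ℤ → ℝ} (hu : ∀ n, 0 ≤ u n) (hv : ∀ n, 0 ≤ v n)
    (hus : Summable fun n => u n ^ p * ω n ^ p) (hvs : Summable fun n => v n ^ p * ω n ^ p) (n : ℤ) :
    (∑' k, u k * v (n - k)) ^ p * ω n ^ p ≤
      ∑' k, (u k ^ p * ω k ^ p) * (v (n - k) ^ p * ω (n - k) ^ p) := by
  have h0 : ∀ n, 0 < ω n := fun n => zero_lt_one.trans_le (hω.one_le n)
  have hp0 := hpq.pos
  have hq0 := hpq.symm.pos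
  have hUnn : ∀ n, 0 ≤ u n ^ p * ω n ^ p := fun n =>
    mul_nonneg (Real.rpow_nonneg (hu n) _) (Real.rpow_nonneg (h0 n).le _)
  have hVnn : ∀ n, 0 ≤ v n ^ p * ω n ^ p := fun n =>
    mul_nonneg (Real.rpow_nonneg (hv n) _) (Real.rpow_nonneg (h0 n).le _)
  have hF : ∀ k, ((u k * ω k) * (v (n - k) * ω (n - k))) ^ p
      = (u k ^ p * ω k ^ p) * (v (n - k) ^ p * ω (n - k) ^ p) := fun k => by
    rw [Real.mul_rpow (mul_nonneg (hu _) (h0 _).le) (mul_nonneg (hv _) (h0 _).le),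
      Real.mul_rpow (hu _) (h0 _).le, Real.mul_rpow (hv _) (h0 _).le]
  have hG : ∀ k, ((ω k)⁻¹ * (ω (n - k))⁻¹) ^ q = ω k ^ (-q) * ω (n - k) ^ (-q) := fun k => by
    rw [Real.mul_rpow (inv_nonneg.2 (h0 _).le) (inv_nonneg.2 (h0 _).le), Real.inv_rpow (h0 _).le,
      Real.inv_rpow (h0 _).le, Real.rpow_neg (h0 _).le, Real.rpow_neg (h0 _).le]
  have hGs : Summable fun k => ω k ^ (-q) * ω (n - k) ^ (-q) :=
    hω.summable.of_nonneg_of_le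
      (fun k => mul_nonneg (Real.rpow_nonneg (h0 _).le _) (Real.rpow_nonneg (h0 _).le _)) fun k =>
      mul_le_of_le_one_right (Real.rpow_nonneg (h0 _).le _)
        (Real.rpow_le_one_of_one_le_of_nonpos (hω.one_le _) (by linarith))
  have hFs : Summable fun k => (u k ^ p * ω k ^ p) * (v (n - k) ^ p * ω (n - k) ^ p) :=
    (hasSum_convolution (hus.congr fun k => (Real.norm_of_nonneg (hUnn k)).symm)
      (hvs.congr fun k => (Real.norm_of_nonneg (hVnn k)).symm)).1 n
  have hH := (Real.summable_and_inner_le_Lp_mul_Lq_tsum_of_nonneg hpq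
    (f := fun k => (u k * ω k) * (v (n - k) * ω (n - k)))
    (g := fun k => (ω k)⁻¹ * (ω (n - k))⁻¹)
    (fun k => mul_nonneg (mul_nonneg (hu _) (h0 _).le) (mul_nonneg (hv _) (h0 _).le))
    (fun k => mul_nonneg (inv_nonneg.2 (h0 _).le) (inv_nonneg.2 (h0 _).le))
    (by simpa only [hF] using hFs) (by simpa only [hG] using hGs)).2
  simp only [hF, hG] at hH
  have hcancel : ∀ k, u k * ω k * (v (n - k) * ω (n - k)) * ((ω k)⁻¹ * (ω (n - k))⁻¹)
      = u k * v (n - k) := fun k => by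
    have := (h0 k).ne'
    have := (h0 (n - k)).ne'
    field_simp
  simp only [hcancel] at hH
  set D := ∑' k, (u k ^ p * ω k ^ p) * (v (n - k) ^ p * ω (n - k) ^ p) with hD
  have hD0 : 0 ≤ D := tsum_nonneg fun k => mul_nonneg (hUnn _) (hVnn _)
  have hwq : (∑' k, ω k ^ (-q) * ω (n - k) ^ (-q)) ^ (1 / q) ≤ (ω n)⁻¹ := by
    calc _ ≤ (ω n ^ (-q)) ^ (1 / q) := by
          gcongr
          · exact tsum_nonneg fun k =>
              mul_nonneg (Real.rpow_nonneg (h0 _).le _) (Real.rpow_nonneg (h0 _).le _)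
          · exact hω.conv_le n
      _ = _ := by
          rw [← Real.rpow_mul (h0 n).le, neg_mul, mul_one_div_cancel hq0.ne', Real.rpow_neg_one]
  have hle : (∑' k, u k * v (n - k)) * ω n ≤ D ^ (1 / p) := by
    rw [← le_mul_inv_iff₀ (h0 n)]
    exact hH.trans (mul_le_mul_of_nonneg_left hwq (Real.rpow_nonneg hD0 _))
  have hc0 : 0 ≤ ∑' k, u k * v (n - k) := tsum_nonneg fun k => mul_nonneg (hu _) (hv _)
  rw [← Real.mul_rpow hc0 (h0 n).le]
  calc _ ≤ (D ^ (1 / p)) ^ p :=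
        Real.rpow_le_rpow (mul_nonneg hc0 (h0 n).le) hle hp0.le
    _ = D := by rw [← Real.rpow_mul hD0, one_div_mul_cancel hp0.ne', Real.rpow_one]

end Holder

/-! ### The Banach algebra of functions with ACFS -/

section Algebra

variable {A : Type*} [NormedRing A] [NormedAlgebra ℂ A] {p q : ℝ} {ω : ℤ → ℝ}

theorem norm_smul_weight_rpow (hω : IsWeight ω) (n : ℤ) (a : A) :
    ‖(ω n : ℂ) • a‖ ^ p = ‖a‖ ^ p * ω n ^ p := by
  have h0 : 0 ≤ ω n := zero_le_one.trans (hω.one_le n)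
  rw [norm_smul, Complex.norm_real, Real.norm_of_nonneg h0, Real.mul_rpow h0 (norm_nonneg _),
    mul_comm]

theorem HasACFS.summable_norm (hpq : p.HolderConjugate q)
    (hω : IsAlmostMonotoneAlgebraWeight q ω) {f : C(Circle, A)} (hf : HasACFS p ω f) :
    Summable fun n => ‖fourierCoefficient f n‖ :=
  summable_of_summable_rpow_mul_weight hpq hω (fun _ => norm_nonneg _) hf.summable

theorem toReal_ofReal_exponent (hpq : p.HolderConjugate q) : (ENNReal.ofReal p).toReal = p :=
  ENNReal.toReal_ofReal hpq.pos.le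

theorem memlp_weighted_iff (hpq : p.HolderConjugate q) (hω : IsWeight ω) (c : ℤ → A) :
    Memℓp (fun n => (ω n : ℂ) • c n) (ENNReal.ofReal p) ↔
      Summable fun n => ‖c n‖ ^ p * ω n ^ p := by
  rw [memℓp_gen_iff (by rw [toReal_ofReal_exponent hpq]; exact hpq.pos),
    toReal_ofReal_exponent hpq]
  simp only [norm_smul_weight_rpow hω]

theorem HasACFS.add (hpq : p.HolderConjugate q) (hω : IsWeight ω) {f g : C(Circle, A)}
    (hf : HasACFS p ω f) (hg : HasACFS p ω g) : HasACFS p ω (f + g) := by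
  refine ⟨fun z => ?_, ?_⟩
  · simpa only [fourierCoefficient_add, smul_add, ContinuousMap.add_apply]
      using (hf.hasSum z).add (hg.hasSum z)
  · rw [← memlp_weighted_iff hpq hω]
    have := ((memlp_weighted_iff hpq hω _).2 hf.summable).add
      ((memlp_weighted_iff hpq hω _).2 hg.summable)
    simp only [fourierCoefficient_add, smul_add]
    exact this

variable [CompleteSpace A]

/-- The definition gives pointwise convergence only; absolute summability of the coefficients
upgrades it to convergence in `C(Circle, A)`. -/
theorem HasACFS.hasSum_monomial (hpq : p.HolderConjugate q)
    (hω : IsAlmostMonotoneAlgebraWeight q ω) {f : C(Circle, A)} (hf : HasACFS p ω f) :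
    HasSum (fun n => monomial n (fourierCoefficient f n)) f := by
  obtain ⟨F, hF⟩ := exists_hasSum_monomial (hf.summable_norm hpq hω)
  have : F = f := by
    ext z
    exact (hasSum_apply_of_hasSum_monomial hF z).unique (hf.hasSum z)
  exact this ▸ hF

theorem hasACFS_of_hasSum_monomial {c : ℤ → A} {f : C(Circle, A)}
    (h : HasSum (fun n => monomial n (c n)) f) (hc : Summable fun n => ‖c n‖ ^ p * ω n ^ p) :
    HasACFS p ω f := by
  have := funext (fourierCoefficient_eq_of_hasSum h)
  refine ⟨fun z => ?_, ?_⟩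
  · simpa only [this] using hasSum_apply_of_hasSum_monomial h z
  · simpa only [this] using hc

theorem hasACFS_monomial (hp : 0 < p) (m : ℤ) (a : A) : HasACFS p ω (monomial m a) := by
  refine hasACFS_of_hasSum_monomial (c := fun n => if n = m then a else 0) ?_ ?_
  · refine (hasSum_ite_eq m (monomial m a)).congr_fun fun n => ?_
    split_ifs with h <;> simp [h]
  · refine summable_of_ne_finset_zero (s := {m}) fun n hn => ?_
    rw [Finset.mem_singleton] at hn
    simp [hn, Real.zero_rpow hp.ne']

theorem HasACFS.fourierCoefficient_mul (hpq : p.HolderConjugate q)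
    (hω : IsAlmostMonotoneAlgebraWeight q ω) {f g : C(Circle, A)}
    (hf : HasACFS p ω f) (hg : HasACFS p ω g) (n : ℤ) :
    fourierCoefficient (f * g) n =
      ∑' k, fourierCoefficient f k * fourierCoefficient g (n - k) :=
  fourierCoefficient_eq_of_hasSum (hasSum_monomial_mul (hf.summable_norm hpq hω)
    (hg.summable_norm hpq hω) (hf.hasSum_monomial hpq hω) (hg.hasSum_monomial hpq hω)) n

/-- The weighted `p`-norms of Fourier coefficients are submultiplicative. -/
theorem HasACFS.mul_bound (hpq : p.HolderConjugate q)
    (hω : IsAlmostMonotoneAlgebraWeight q ω) {f g : C(Circle, A)}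
    (hf : HasACFS p ω f) (hg : HasACFS p ω g) :
    (Summable fun n => ‖fourierCoefficient (f * g) n‖ ^ p * ω n ^ p) ∧
      ∑' n, ‖fourierCoefficient (f * g) n‖ ^ p * ω n ^ p ≤
        (∑' n, ‖fourierCoefficient f n‖ ^ p * ω n ^ p) *
          ∑' n, ‖fourierCoefficient g n‖ ^ p * ω n ^ p := by
  have h0 : ∀ n, 0 < ω n := fun n => zero_lt_one.trans_le (hω.one_le n)
  have hnn : ∀ (h : C(Circle, A)) (n : ℤ), 0 ≤ ‖fourierCoefficient h n‖ ^ p * ω n ^ p :=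
    fun h n => mul_nonneg (Real.rpow_nonneg (norm_nonneg _) _) (Real.rpow_nonneg (h0 n).le _)
  have hconv := (hasSum_convolution
    (hf.summable.congr fun k => (Real.norm_of_nonneg (hnn f k)).symm)
    (hg.summable.congr fun k => (Real.norm_of_nonneg (hnn g k)).symm)).2
  have hle : ∀ n, ‖fourierCoefficient (f * g) n‖ ^ p * ω n ^ p ≤
      ∑' k, (‖fourierCoefficient f k‖ ^ p * ω k ^ p) *
        (‖fourierCoefficient g (n - k)‖ ^ p * ω (n - k) ^ p) := by
    intro n
    refine le_trans ?_ (convolution_rpow_le hpq hω (fun _ => norm_nonneg _)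
      (fun _ => norm_nonneg _) hf.summable hg.summable n)
    have hs := (hasSum_convolution
      ((hf.summable_norm hpq hω).congr fun k => (norm_norm _).symm)
      ((hg.summable_norm hpq hω).congr fun k => (norm_norm _).symm)).1 n
    have hp0 := hpq.pos
    have := (h0 n).le
    gcongr
    rw [hf.fourierCoefficient_mul hpq hω hg]
    exact tsum_of_norm_bounded hs.hasSum fun k => norm_mul_le _ _
  have hs := hconv.summable.of_nonneg_of_le (hnn _) hle
  exact ⟨hs, (hs.tsum_le_tsum hle hconv.summable).trans_eq hconv.tsum_eq⟩

theorem HasACFS.mul (hpq : p.HolderConjugate q)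
    (hω : IsAlmostMonotoneAlgebraWeight q ω) {f g : C(Circle, A)}
    (hf : HasACFS p ω f) (hg : HasACFS p ω g) : HasACFS p ω (f * g) := by
  have h := hasSum_monomial_mul (hf.summable_norm hpq hω) (hg.summable_norm hpq hω)
    (hf.hasSum_monomial hpq hω) (hg.hasSum_monomial hpq hω)
  refine hasACFS_of_hasSum_monomial h ?_
  simpa only [fourierCoefficient_eq_of_hasSum h] using (hf.mul_bound hpq hω hg).1

variable (A) in
/-- The functions with `p`-th power `ω`-absolutely convergent Fourier series. -/
def acfsSubalgebra (hpq : p.HolderConjugate q) (hω : IsAlmostMonotoneAlgebraWeight q ω) :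
    Subalgebra ℂ C(Circle, A) where
  carrier := {f | HasACFS p ω f}
  mul_mem' hf hg := hf.mul hpq hω hg
  add_mem' hf hg := hf.add hpq hω.toIsWeight hg
  algebraMap_mem' r := by
    have : algebraMap ℂ C(Circle, A) r = monomial 0 (algebraMap ℂ A r) := by
      ext z
      simp [monomial_apply, Algebra.algebraMap_eq_smul_one]
    change HasACFS p ω _
    rw [this]
    exact hasACFS_monomial hpq.pos 0 _

variable (A) in
/-- The algebra of functions with `p`-th power `ω`-absolutely convergent Fourier series, to be
normed by the weighted `p`-norm of the Fourier coefficients. -/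
def ACFSAlgebra (hpq : p.HolderConjugate q) (hω : IsAlmostMonotoneAlgebraWeight q ω) : Type _ :=
  acfsSubalgebra A hpq hω

namespace ACFSAlgebra

variable (hpq : p.HolderConjugate q) (hω : IsAlmostMonotoneAlgebraWeight q ω)

noncomputable instance : Ring (ACFSAlgebra A hpq hω) :=
  inferInstanceAs (Ring (acfsSubalgebra A hpq hω))

noncomputable instance : Algebra ℂ (ACFSAlgebra A hpq hω) :=
  inferInstanceAs (Algebra ℂ (acfsSubalgebra A hpq hω))

variable {hpq hω} in
/-- The underlying continuous function. -/
noncomputable def toFun : ACFSAlgebra A hpq hω →ₐ[ℂ] C(Circle, A) := (acfsSubalgebra A hpq hω).val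

variable {hpq hω} in
theorem hasACFS (f : ACFSAlgebra A hpq hω) : HasACFS p ω (toFun f) := f.2

variable {hpq hω} in
theorem toFun_injective : Function.Injective (toFun : ACFSAlgebra A hpq hω → C(Circle, A)) :=
  Subtype.val_injective

/-- The weighted sequence of Fourier coefficients. -/
noncomputable def toLp : ACFSAlgebra A hpq hω →ₗ[ℂ] lp (fun _ : ℤ => A) (ENNReal.ofReal p) where
  toFun f := ⟨fun n => (ω n : ℂ) • fourierCoefficient (toFun f) n,
    (memlp_weighted_iff hpq hω.toIsWeight _).2 f.hasACFS.summable⟩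
  map_add' f g := by
    ext n
    simp only [map_add, fourierCoefficient_add, smul_add]
    rfl
  map_smul' c f := by
    ext n
    simp [fourierCoefficient_smul, smul_comm c]

theorem toLp_apply (f : ACFSAlgebra A hpq hω) (n : ℤ) :
    toLp hpq hω f n = (ω n : ℂ) • fourierCoefficient (toFun f) n := rfl

theorem toLp_injective : Function.Injective (toLp hpq hω (A := A)) := by
  intro f g h
  apply toFun_injective
  ext z
  refine (f.hasACFS.hasSum z).unique ?_
  convert g.hasACFS.hasSum z using 3 with n
  have hn := congrFun (congrArg Subtype.val h) n
  have h0 : (ω n : ℂ) ≠ 0 :=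
    Complex.ofReal_ne_zero.2 (zero_lt_one.trans_le (hω.one_le n)).ne'
  exact smul_right_injective A h0 hn

theorem toLp_surjective : Function.Surjective (toLp hpq hω (A := A)) := by
  intro x
  have h0 : ∀ n, (ω n : ℂ) ≠ 0 := fun n =>
    Complex.ofReal_ne_zero.2 (zero_lt_one.trans_le (hω.one_le n)).ne'
  have hs : Summable fun n => ‖(ω n : ℂ)⁻¹ • x n‖ ^ p * ω n ^ p := by
    rw [← memlp_weighted_iff hpq hω.toIsWeight]
    simp only [smul_inv_smul₀ (h0 _)]
    exact lp.memℓp x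
  obtain ⟨F, hF⟩ := exists_hasSum_monomial
    (summable_of_summable_rpow_mul_weight hpq hω (fun n => norm_nonneg _) hs)
  refine ⟨⟨F, hasACFS_of_hasSum_monomial hF hs⟩, ?_⟩
  ext n
  change (ω n : ℂ) • fourierCoefficient F n = x n
  rw [fourierCoefficient_eq_of_hasSum hF, smul_inv_smul₀ (h0 n)]

theorem fact_one_le_ofReal (hpq : p.HolderConjugate q) : Fact (1 ≤ ENNReal.ofReal p) :=
  ⟨ENNReal.one_le_ofReal.2 hpq.lt.le⟩

noncomputable instance : NormedAddCommGroup (ACFSAlgebra A hpq hω) :=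
  haveI := fact_one_le_ofReal hpq
  NormedAddCommGroup.induced _ _ (toLp hpq hω (A := A)) (toLp_injective hpq hω)

theorem norm_def (f : ACFSAlgebra A hpq hω) : ‖f‖ = ‖toLp hpq hω f‖ := rfl

theorem norm_eq (f : ACFSAlgebra A hpq hω) :
    ‖f‖ = (∑' n, ‖fourierCoefficient (toFun f) n‖ ^ p * ω n ^ p) ^ (1 / p) := by
  rw [norm_def, lp.norm_eq_tsum_rpow (by rw [toReal_ofReal_exponent hpq]; exact hpq.pos),
    toReal_ofReal_exponent hpq]
  simp only [toLp_apply, norm_smul_weight_rpow hω.toIsWeight]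

noncomputable instance : NormedRing (ACFSAlgebra A hpq hω) where
  __ := (inferInstance : NormedAddCommGroup (ACFSAlgebra A hpq hω))
  __ := (inferInstance : Ring (ACFSAlgebra A hpq hω))
  norm_mul_le f g := by
    have h0 : ∀ n, 0 ≤ ω n := fun n => zero_le_one.trans (hω.one_le n)
    have hp := hpq.pos
    have hnn : ∀ h : ACFSAlgebra A hpq hω,
        0 ≤ ∑' n, ‖fourierCoefficient (toFun h) n‖ ^ p * ω n ^ p := fun h =>
      tsum_nonneg fun n => mul_nonneg (Real.rpow_nonneg (norm_nonneg _) _)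
        (Real.rpow_nonneg (h0 n) _)
    rw [norm_eq, norm_eq, norm_eq, ← Real.mul_rpow (hnn f) (hnn g)]
    refine Real.rpow_le_rpow (hnn _) ?_ (by positivity)
    rw [map_mul]
    exact (f.hasACFS.mul_bound hpq hω g.hasACFS).2

noncomputable instance : NormedAlgebra ℂ (ACFSAlgebra A hpq hω) where
  norm_smul_le c f := by
    have := fact_one_le_ofReal hpq
    rw [norm_def, norm_def, map_smul, norm_smul]

theorem isometry_toLp : haveI := fact_one_le_ofReal hpq; Isometry (toLp hpq hω (A := A)) :=
  haveI := fact_one_le_ofReal hpq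
  AddMonoidHomClass.isometry_of_norm _ fun _ => rfl

/-- The weighted coefficient map is an isometry onto `ℓ^p`: every weighted `ℓ^p` sequence has
summable norms and so defines a continuous function. -/
instance : CompleteSpace (ACFSAlgebra A hpq hω) := by
  have := fact_one_le_ofReal hpq
  rw [(isometry_toLp hpq hω).isUniformInducing.completeSpace_congr (toLp_surjective hpq hω)]
  infer_instance

/-- The monomial `z ↦ z ^ n • a`. -/
noncomputable def mono (n : ℤ) (a : A) : ACFSAlgebra A hpq hω :=
  ⟨monomial n a, hasACFS_monomial hpq.pos n a⟩

theorem toFun_mono (n : ℤ) (a : A) : toFun (mono hpq hω n a) = monomial n a := rfl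

theorem mono_mul (m n : ℤ) (a b : A) :
    mono hpq hω m a * mono hpq hω n b = mono hpq hω (m + n) (a * b) :=
  toFun_injective (by rw [map_mul, toFun_mono, toFun_mono, toFun_mono, monomial_mul])

theorem mono_zero_one : mono hpq hω 0 (1 : A) = 1 :=
  toFun_injective (by rw [map_one, toFun_mono, monomial_zero_one])

theorem smul_mono (c : ℂ) (n : ℤ) (a : A) : c • mono hpq hω n a = mono hpq hω n (c • a) :=
  toFun_injective (by rw [map_smul, toFun_mono, toFun_mono, map_smul])

theorem toLp_mono (n : ℤ) (a : A) :
    toLp hpq hω (mono hpq hω n a) = lp.single _ n ((ω n : ℂ) • a) := by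
  ext m
  rw [toLp_apply, toFun_mono, fourierCoefficient_monomial, lp.single_apply]
  rcases eq_or_ne m n with rfl | h
  · simp
  · simp [h]

theorem norm_mono (n : ℤ) (a : A) : ‖mono hpq hω n a‖ = ω n * ‖a‖ := by
  rw [norm_def, toLp_mono, lp.norm_single (ENNReal.ofReal_pos.2 hpq.pos), norm_smul,
    Complex.norm_real, Real.norm_of_nonneg (zero_le_one.trans (hω.one_le n))]

/-- Convergence in the weighted norm, from `p < ∞`; this permits limits inside closed ideals of the
algebra. -/
theorem hasSum_mono (f : ACFSAlgebra A hpq hω) :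
    HasSum (fun n => mono hpq hω n (fourierCoefficient (toFun f) n)) f := by
  have := fact_one_le_ofReal hpq
  have h := lp.hasSum_single ENNReal.ofReal_ne_top (toLp hpq hω f)
  rw [← (isometry_toLp hpq hω).isEmbedding.isInducing.hasSum_iff]
  refine h.congr_fun fun n => ?_
  rw [Function.comp_apply, toLp_mono, toLp_apply]

/-- The constant functions. -/
noncomputable def const : A →L[ℂ] ACFSAlgebra A hpq hω :=
  LinearMap.mkContinuous
    { toFun := mono hpq hω 0
      map_add' := fun a b => toFun_injective (by simp [toFun_mono])
      map_smul' := fun c a => (smul_mono hpq hω c 0 a).symm } (ω 0)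
    fun a => (norm_mono hpq hω 0 a).le

theorem const_apply (a : A) : const hpq hω a = mono hpq hω 0 a := rfl

end ACFSAlgebra

end Algebra

/-! ### Wiener's lemma -/

section Inverse

open ACFSAlgebra

theorem Subexponential.le_one_of_pow_le {ω : ℤ → ℝ} (h : Subexponential ω) {x C : ℝ} (hC : 0 ≤ C)
    (hx : ∀ n : ℕ, x ^ n ≤ C * ω n) : x ≤ 1 := by
  refine le_of_forall_gt_imp_ge_of_dense fun r hr => ?_
  obtain ⟨B, -, hB⟩ := h r hr
  refine le_of_pow_le_const_mul_pow (C := C * B) (by linarith) fun n => (hx n).trans ?_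
  rw [mul_assoc]
  exact mul_le_mul_of_nonneg_left (hB n) hC

theorem exists_pos_le_norm_one_sub {R : Type*} [NormedRing R] {M : Ideal R}
    (hM : IsClosed (M : Set R)) (h1 : (1 : R) ∉ M) : ∃ δ : ℝ, 0 < δ ∧ ∀ x ∈ M, δ ≤ ‖1 - x‖ := by
  obtain ⟨δ, hδ, h⟩ := Metric.isOpen_iff.1 hM.isOpen_compl 1 h1
  refine ⟨δ, hδ, fun x hx => ?_⟩
  by_contra! hlt
  exact h (by rwa [Metric.mem_ball, dist_comm, dist_eq_norm]) hx

/-- Induction in both directions on `z^(n+1) - μ^(n+1) = z^n (z - μ) + μ (z^n - μ^n)`; going down,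
the scalar `μ` is cancelled. -/
theorem zpow_sub_zpow_mem {R : Type*} [Ring R] [Algebra ℂ R] {M : Ideal R} (z : Rˣ) {μ : ℂ}
    (hμ : μ ≠ 0) (h : (z : R) - algebraMap ℂ R μ ∈ M) (n : ℤ) :
    ((z ^ n : Rˣ) : R) - algebraMap ℂ R (μ ^ n) ∈ M := by
  have step : ∀ n : ℤ, ((z ^ (n + 1) : Rˣ) : R) - algebraMap ℂ R (μ ^ (n + 1)) =
      ((z ^ n : Rˣ) : R) * ((z : R) - algebraMap ℂ R μ) +
        algebraMap ℂ R μ * (((z ^ n : Rˣ) : R) - algebraMap ℂ R (μ ^ n)) := by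
    intro n
    rw [zpow_add_one, zpow_add_one₀ hμ, Units.val_mul, map_mul, mul_sub, mul_sub,
      Algebra.commutes μ, Algebra.commutes μ]
    abel
  induction n using Int.induction_on with
  | zero => simp
  | succ n ih =>
    rw [step]
    exact M.add_mem (M.mul_mem_left _ h) (M.mul_mem_left _ ih)
  | pred n ih =>
    have h2 := step (-n - 1)
    rw [sub_add_cancel] at h2
    rw [h2, M.add_mem_iff_right (M.mul_mem_left _ h)] at ih
    have h3 := M.mul_mem_left (algebraMap ℂ R μ⁻¹) ih
    rwa [← mul_assoc, ← map_mul, inv_mul_cancel₀ hμ, map_one, one_mul] at h3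

variable {A : Type*} [NormedRing A] [NormedAlgebra ℂ A] [CompleteSpace A] {p q : ℝ} {ω : ℤ → ℝ}

/-- The independent variable as a unit. -/
noncomputable def ACFSAlgebra.variableUnit (hpq : p.HolderConjugate q)
    (hω : IsAlmostMonotoneAlgebraWeight q ω) : (ACFSAlgebra A hpq hω)ˣ where
  val := mono hpq hω 1 1
  inv := mono hpq hω (-1) 1
  val_inv := by rw [mono_mul, add_neg_cancel, mul_one, mono_zero_one]
  inv_val := by rw [mono_mul, neg_add_cancel, mul_one, mono_zero_one]

theorem ACFSAlgebra.variableUnit_zpow (hpq : p.HolderConjugate q)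
    (hω : IsAlmostMonotoneAlgebraWeight q ω) (n : ℤ) :
    ((variableUnit hpq hω ^ n : (ACFSAlgebra A hpq hω)ˣ) : ACFSAlgebra A hpq hω) =
      mono hpq hω n 1 := by
  induction n using Int.induction_on with
  | zero => simp [mono_zero_one]
  | succ n ih =>
    rw [zpow_add_one, Units.val_mul, ih]
    exact (mono_mul hpq hω _ _ _ _).trans (by rw [mul_one])
  | pred n ih =>
    rw [zpow_sub_one, Units.val_mul, ih]
    exact (mono_mul hpq hω _ _ _ _).trans (by rw [mul_one, sub_eq_add_neg])

/-- **Wiener's lemma** for left inverses and admissible weights. -/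
theorem exists_left_inverse (hpq : p.HolderConjugate q)
    (hω : IsAlmostMonotoneAlgebraWeight q ω) (hadm : IsAdmissible ω) {f : C(Circle, A)}
    (hf : HasACFS p ω f) (hinv : ∀ z : Circle, ∃ b : A, b * f z = 1) :
    ∃ g : C(Circle, A), HasACFS p ω g ∧ g * f = 1 := by
  by_contra! hcon
  let W := ACFSAlgebra A hpq hω
  let F : W := ⟨f, hf⟩
  have hF : toFun F = f := rfl
  let Z : Wˣ := variableUnit hpq hω
  have hZ : ∀ n : ℤ, ((Z ^ n : Wˣ) : W) = mono hpq hω n 1 := variableUnit_zpow hpq hω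
  have hcomm : ∀ x : W, (Z : W) * x = x * Z := fun x => toFun_injective (by
    ext z
    rw [map_mul, map_mul, ContinuousMap.mul_apply, ContinuousMap.mul_apply]
    change monomial 1 1 z * _ = _ * monomial 1 1 z
    simp [monomial_apply])
  obtain ⟨M, μ, hclosed, h1, hFM, hZM⟩ := exists_maximal_left_ideal (Z : W) F hcomm fun g hg =>
    hcon (toFun g) g.hasACFS (by rw [← hF, ← map_mul, hg, map_one])
  have hμ : μ ≠ 0 := by
    rintro rfl
    rw [map_zero, sub_zero] at hZM
    exact h1 (by simpa using M.mul_mem_left (Z⁻¹ : Wˣ) hZM)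
  have hmem := zpow_sub_zpow_mem Z hμ hZM
  obtain ⟨δ, hδ, hdist⟩ := exists_pos_le_norm_one_sub hclosed h1
  have hbound : ∀ n : ℤ, ‖μ‖ ^ n ≤ ‖(1 : A)‖ / δ * ω n := by
    intro n
    -- The element of `M` is chosen so that its difference from `1` is `μ^(-n) z^n`, of norm
    -- `‖μ‖^(-n) * ω n * ‖1‖`.
    have h2 := hdist _ (M.mul_mem_left (-algebraMap ℂ W (μ ^ n)⁻¹) (hmem n))
    rw [neg_mul, sub_neg_eq_add, mul_sub, ← map_mul, inv_mul_cancel₀ (zpow_ne_zero n hμ), map_one,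
      add_sub_cancel, ← Algebra.smul_def, hZ, norm_smul, norm_mono, norm_inv, norm_zpow,
      le_inv_mul_iff₀ (by positivity)] at h2
    rw [div_mul_eq_mul_div, le_div_iff₀ hδ]
    linarith
  have hC : 0 ≤ ‖(1 : A)‖ / δ := by positivity
  have hg2 : Subexponential ω :=
    hω.subexponential ((rho2_eq_one_iff hω.one_le).1 hadm.rho2_eq)
  have hg1 : Subexponential fun n => ω (-n) :=
    hω.neg.subexponential ((rho2_eq_one_iff hω.neg.one_le).1
      ((rho1_eq_one_iff_rho2 hω.one_le).1 hadm.rho1_eq))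
  have hle : ‖μ‖ ≤ 1 := hg2.le_one_of_pow_le hC fun n => by simpa using hbound n
  have hge : ‖μ‖⁻¹ ≤ 1 := hg1.le_one_of_pow_le hC fun n => by simpa using hbound (-n)
  have hnorm : ‖μ‖ = 1 :=
    le_antisymm hle ((inv_le_one₀ (norm_pos_iff.2 hμ)).1 hge)
  let ζ : Circle := ⟨μ, mem_sphere_zero_iff_norm.2 hnorm⟩
  -- With `a_n` the coefficients of `f`, this is `f - f(ζ) = ∑ a_n (z^n - ζ^n)`; each term is a left
  -- multiple of `z^n - μ^n`, hence in `M`.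
  have hsum : HasSum (fun n : ℤ => mono hpq hω n (fourierCoefficient f n) -
      const hpq hω (μ ^ n • fourierCoefficient f n)) (F - const hpq hω (f ζ)) :=
    (hasSum_mono hpq hω F).sub ((const hpq hω).hasSum (hf.hasSum ζ))
  have hterm : ∀ n : ℤ, mono hpq hω n (fourierCoefficient f n) -
      const hpq hω (μ ^ n • fourierCoefficient f n) ∈ M := by
    intro n
    have := M.mul_mem_left (mono hpq hω 0 (fourierCoefficient f n)) (hmem n)
    rwa [hZ, mul_sub, mono_mul, zero_add, mul_one, ← Algebra.commutes, ← Algebra.smul_def,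
      smul_mono] at this
  have hlim : F - const hpq hω (f ζ) ∈ M :=
    hclosed.mem_of_tendsto hsum (Filter.Eventually.of_forall fun s =>
      M.sum_mem fun n _ => hterm n)
  have hconst : const hpq hω (f ζ) ∈ M := (Submodule.sub_mem_iff_right M hFM).1 hlim
  obtain ⟨b, hb⟩ := hinv ζ
  have := M.mul_mem_left (const hpq hω b) hconst
  rw [const_apply, const_apply, mono_mul, hb, add_zero, mono_zero_one] at this
  exact h1 this

theorem fourierCoefficient_comp_isometry {B : Type*} [NormedRing B] [NormedAlgebra ℂ B]
    [CompleteSpace B] (T : A ≃ₗᵢ[ℂ] B) {f : C(Circle, A)} {g : C(Circle, B)}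
    (h : ∀ z, g z = T (f z)) (n : ℤ) : fourierCoefficient g n = T (fourierCoefficient f n) := by
  simp only [fourierCoefficient, h, map_smul]
  have := T.toLinearIsometry.intervalIntegral_comp_comm (a := 0) (b := 2 * Real.pi)
    (μ := MeasureTheory.volume) fun t : ℝ =>
      Complex.exp (-((n : ℂ) * (t : ℂ) * Complex.I)) • f (Circle.exp t)
  simp only [map_smul, LinearIsometryEquiv.coe_toLinearIsometry] at this
  rw [this]

theorem HasACFS.comp_isometry {B : Type*} [NormedRing B] [NormedAlgebra ℂ B]
    [CompleteSpace B] (T : A ≃ₗᵢ[ℂ] B) {f : C(Circle, A)} {g : C(Circle, B)}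
    (h : ∀ z, g z = T (f z)) (hf : HasACFS p ω f) : HasACFS p ω g := by
  refine ⟨fun z => ?_, ?_⟩
  · simp only [fourierCoefficient_comp_isometry T h, h, ← map_smul]
    exact T.toContinuousLinearEquiv.toContinuousLinearMap.hasSum (hf.hasSum z)
  · simpa only [fourierCoefficient_comp_isometry T h, T.norm_map] using hf.summable

/-- **Wiener's lemma** for right inverses and admissible weights. -/
theorem exists_right_inverse (hpq : p.HolderConjugate q)
    (hω : IsAlmostMonotoneAlgebraWeight q ω) (hadm : IsAdmissible ω) {f : C(Circle, A)}
    (hf : HasACFS p ω f) (hinv : ∀ z : Circle, ∃ b : A, f z * b = 1) :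
    ∃ g : C(Circle, A), HasACFS p ω g ∧ f * g = 1 := by
  let T : A ≃ₗᵢ[ℂ] Aᵐᵒᵖ := MulOpposite.opLinearIsometryEquiv ℂ A
  let f' : C(Circle, Aᵐᵒᵖ) := ⟨fun z => T (f z), T.continuous.comp f.continuous⟩
  obtain ⟨g, hg, hgf⟩ := exists_left_inverse hpq hω hadm (hf.comp_isometry T (g := f') fun _ => rfl)
    fun z => by
      obtain ⟨b, hb⟩ := hinv z
      exact ⟨MulOpposite.op b, congrArg MulOpposite.op hb⟩
  refine ⟨⟨fun z => T.symm (g z), T.symm.continuous.comp g.continuous⟩,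
    hg.comp_isometry T.symm fun _ => rfl, ?_⟩
  ext z
  exact congrArg MulOpposite.unop (DFunLike.congr_fun hgf z)

/-- **Wiener's lemma** for two-sided inverses and admissible weights. -/
theorem exists_inverse (hpq : p.HolderConjugate q)
    (hω : IsAlmostMonotoneAlgebraWeight q ω) (hadm : IsAdmissible ω) {f : C(Circle, A)}
    (hf : HasACFS p ω f) (hinv : ∀ z : Circle, IsUnit (f z)) :
    ∃ g : C(Circle, A), HasACFS p ω g ∧ g * f = 1 ∧ f * g = 1 := by
  obtain ⟨g, hg, hgf⟩ := exists_left_inverse hpq hω hadm hf fun z => (hinv z).exists_left_inv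
  refine ⟨g, hg, hgf, ?_⟩
  ext z
  -- Pointwise, a left inverse of a unit is its two-sided inverse.
  obtain ⟨b, hb⟩ := (hinv z).exists_right_inv
  have hz : g z * f z = 1 := DFunLike.congr_fun hgf z
  change f z * g z = 1
  rw [left_inv_eq_right_inv hz hb, hb]

omit [CompleteSpace A] in
theorem HasACFS.mono {ν : ℤ → ℝ} {K : ℝ} (hp : 0 < p) (hν : ∀ n, 0 ≤ ν n) (hω : ∀ n, 0 ≤ ω n)
    (hK : 0 ≤ K) (hle : ∀ n, ν n ≤ K * ω n) {f : C(Circle, A)} (hf : HasACFS p ω f) :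
    HasACFS p ν f := by
  refine ⟨hf.hasSum, (hf.summable.mul_left (K ^ p)).of_nonneg_of_le
    (fun n => mul_nonneg (Real.rpow_nonneg (norm_nonneg _) _) (Real.rpow_nonneg (hν n) _))
    fun n => ?_⟩
  rw [mul_left_comm, ← Real.mul_rpow hK (hω n)]
  have := hν n
  gcongr
  exact hle n

end Inverse

end WeightedACFS

theorem theorem1p2 {A : Type*} [NormedRing A] [NormedAlgebra ℂ A] [CompleteSpace A]
    (p q : ℝ) (hp : 1 < p) (hpq : p.HolderConjugate q)
    (ω : ℤ → ℝ) (hω : WeightedACFS.IsAlmostMonotoneAlgebraWeight q ω)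
    (f : C(Circle, A)) (hf : WeightedACFS.HasACFS p ω f) :
    -- left inverses
    ((∀ z : Circle, ∃ b : A, b * f z = 1) →
      (∃ (ν : ℤ → ℝ) (g : C(Circle, A)),
        WeightedACFS.IsAlmostMonotoneAlgebraWeight q ν ∧
        (∃ K : ℝ, 0 < K ∧ ∀ n, 1 ≤ ν n ∧ ν n ≤ K * ω n) ∧
        WeightedACFS.HasACFS p ν g ∧ g * f = 1) ∧
      (WeightedACFS.IsAdmissible ω →
        ∃ g : C(Circle, A), WeightedACFS.HasACFS p ω g ∧ g * f = 1)) ∧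
    -- right inverses
    ((∀ z : Circle, ∃ b : A, f z * b = 1) →
      (∃ (ν : ℤ → ℝ) (g : C(Circle, A)),
        WeightedACFS.IsAlmostMonotoneAlgebraWeight q ν ∧
        (∃ K : ℝ, 0 < K ∧ ∀ n, 1 ≤ ν n ∧ ν n ≤ K * ω n) ∧
        WeightedACFS.HasACFS p ν g ∧ f * g = 1) ∧
      (WeightedACFS.IsAdmissible ω →
        ∃ g : C(Circle, A), WeightedACFS.HasACFS p ω g ∧ f * g = 1)) ∧
    -- two-sided inverses
    ((∀ z : Circle, IsUnit (f z)) →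
      (∃ (ν : ℤ → ℝ) (g : C(Circle, A)),
        WeightedACFS.IsAlmostMonotoneAlgebraWeight q ν ∧
        (∃ K : ℝ, 0 < K ∧ ∀ n, 1 ≤ ν n ∧ ν n ≤ K * ω n) ∧
        WeightedACFS.HasACFS p ν g ∧ g * f = 1 ∧ f * g = 1) ∧
      (WeightedACFS.IsAdmissible ω →
        ∃ g : C(Circle, A), WeightedACFS.HasACFS p ω g ∧ g * f = 1 ∧ f * g = 1)) := by
  -- One admissible `ν` serves all three kinds of inverse; for admissible `ω` the lemmas apply to
  -- `ω` itself.
  obtain ⟨ν, hν, hadm, K, hK, hle⟩ :=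
    WeightedACFS.exists_admissible_weight_le hpq.symm.lt.le hω
  have hfν : WeightedACFS.HasACFS p ν f := hf.mono hpq.pos
    (fun n => zero_le_one.trans (hν.one_le n)) (fun n => zero_le_one.trans (hω.one_le n)) hK.le hle
  have hbd : ∃ K : ℝ, 0 < K ∧ ∀ n, 1 ≤ ν n ∧ ν n ≤ K * ω n :=
    ⟨K, hK, fun n => ⟨hν.one_le n, hle n⟩⟩
  refine ⟨fun h => ⟨?_, fun hω' => WeightedACFS.exists_left_inverse hpq hω hω' hf h⟩,
    fun h => ⟨?_, fun hω' => WeightedACFS.exists_right_inverse hpq hω hω' hf h⟩,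
    fun h => ⟨?_, fun hω' => WeightedACFS.exists_inverse hpq hω hω' hf h⟩⟩
  · obtain ⟨g, hg, hgf⟩ := WeightedACFS.exists_left_inverse hpq hν hadm hfν h
    exact ⟨ν, g, hν, hbd, hg, hgf⟩
  · obtain ⟨g, hg, hfg⟩ := WeightedACFS.exists_right_inverse hpq hν hadm hfν h
    exact ⟨ν, g, hν, hbd, hg, hfg⟩
  · obtain ⟨g, hg, hgf, hfg⟩ := WeightedACFS.exists_inverse hpq hν hadm hfν h
    exact ⟨ν, g, hν, hbd, hg, hgf, hfg⟩
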